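/- Let $\mathcal H$ be a separable complex Hilbert space. Consider the Markov master equation $$\partial_t P_{\tau,t}(B)=\Phi_t(P_{\tau,t}(B))-G_t^*P_{\tau,t}(B)-P_{\tau,t}(B)G_t,\qquad P_{\tau,\tau}(B)=B,\qquad 0\le\tau\le t,\qquad(1.1)$$ with $G_t=\tfrac12\Phi_t(I)+iH_t$, $H_t$ densely defined and symmetric, under the following domain and continuity assumptions (all times are $\ge 0$). (a) There is a strongly continuous evolution system of contractions $W_{s,t}\in\mathcal B(\mathcal H)$, $s\le t$: $W_{t,t}=I$, $W_{s,r}W_{r,t}=W_{s,t}$ for $s\le r\le t$. The densely defined closed operators $G_t$ have a joint core $\mathcal D$, a linear subspace with $\mathcal D\subseteq\operatorname{dom}G_t^N$ for some $N\ge2$ and $W_{s,t}\mathcal D\subseteq\mathcal D$; on $\mathcal D$ one has $\partial_tW_{s,t}=-W_{s,t}G_t$ and $\partial_sW_{s,t}=G_sW_{s,t}$. (b) There is a positive self-adjoint operator $\Lambda$ such that $\Phi_t(X)[\chi,\psi]=\langle\Lambda^{1/2}\chi,A_t(X)\Lambda^{1/2}\psi\rangle$ for $\chi,\psi\in\operatorname{dom}\Lambda^{1/2}$,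 $X\in\mathcal B(\mathcal H)$, where $A_t=\Lambda^{-1/2}\Phi_t(\cdot)\Lambda^{-1/2}$ is a bounded (uniformly in $t$), normal, completely positive map on $\mathcal B(\mathcal H)$ and $t\mapsto A_t(X)$ is ultraweakly continuous for each $X$; moreover $\Lambda\ge\Phi_t(I)\ge I$ as forms on $\operatorname{dom}\Lambda^{1/2}$. (c) $\mathcal D\subseteq\operatorname{dom}\Lambda^{1/2}\cap\operatorname{dom}G_t^*\cap\operatorname{dom}H_t$, and on $\mathcal D$ one has $G_t^*+G_t=\Phi_t(I)$ and $G_t=\frac12\Phi_t(I)+iH_t$. (d) For $\psi\in\mathcal D$ the vectors $\Lambda^{1/2}W_{s,t}\psi$ are in $L_2$ in $s\in[0,t]$ and norm-continuous in $t\in[s,\infty)$. (e) For some Kraus decomposition $A_t(X)=\sum_kA_k(t)^*XA_k(t)$, with $\Phi_k(t)=A_k(t)\Lambda^{1/2}$: $\mathcal D\subseteq\operatorname{dom}\Lambda^{1/2}\Phi_k(t)$ for all $k,t$, and for $\psi\in\mathcal D$ the vectors $\Lambda^{1/2}\Phi_k(s)W_{s,t}\psi$ are in $L_2$ in $s\in[0,t]$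 and norm-continuous in $t\in[s,\infty)$. Put $V_{\tau,t}(B)=W_{\tau,t}^*BW_{\tau,t}$, $P^{(0)}_{\tau,t}=V_{\tau,t}$, and let $P^{(n+1)}_{\tau,t}(B)$ be the bounded operator with the quadratic form $$\langle\psi,V_{\tau,t}(B)\psi\rangle+\int_\tau^t\Phi_s\bigl(P^{(n)}_{\tau,s}(B)\bigr)[W_{s,t}\psi]\,ds,\qquad\psi\in\mathcal D.$$ The minimal solution of (1.1) is $P^{\min}_{\tau,t}(B)=\operatorname{l.u.b.}_nP^{(n)}_{\tau,t}(B)$ for bounded $B\ge0$. For the unbounded operator $\Phi_s(I)$ let $P^{\min}_{s,t}\Phi_s(I)$ be the form $$\psi\mapsto\sup\{\langle\psi,P^{\min}_{s,t}(X)\psi\rangle:\ 0\le X\in\mathcal B(\mathcal H),\ X\le\Phi_s(I)\text{ on }\mathcal D\}\in[0,\infty],$$ and let $\int_\tau^tP^{\min}_{s,t}\Phi_s(I)\,ds$ be the operator associated with the quadratic form $q[\psi]=\int_\tau^t\bigl(P^{\min}_{s,t}\Phi_s(I)\bigr)[\psi]\,ds$, that is, $\psi$ is in its domain, with value $\varphi$,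 if $q[\psi]<\infty$ and $q(\chi,\psi)=\langle\chi,\varphi\rangle$ for all $\chi$ with $q[\chi]<\infty$. **Theorem.** Let $0\le\tau\le t$. If the domain of the operator $\int_\tau^tP^{\min}_{s,t}\Phi_s(I)\,ds$ is dense in $\mathcal H$, then $P^{\min}_{\tau,t}(I)=I$. In particular, if this holds for all $0\le\tau\le t$, the minimal solution of (1.1) is unital. -/

import Mathlib

open scoped InnerProductSpace

noncomputable section

namespace MarkovMaster

variable {H : Type*} [NormedAddCommGroup H] [InnerProductSpace ℂ H]

/-! ### Unbounded operators -/

/-- The value `T x` of a partially defined operator, as a total function of `x`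
(`0` outside of the domain; every use is accompanied by the domain condition). -/
def app (T : H →ₗ.[ℂ] H) (x : H) : H :=
  open Classical in if hx : x ∈ T.domain then T ⟨x, hx⟩ else 0

/-- The domain of the power `T ^ n` of an unbounded operator. -/
def domPow (T : H →ₗ.[ℂ] H) : ℕ → Set H
  | 0 => Set.univ
  | n + 1 => {x | x ∈ T.domain ∧ app T x ∈ domPow T n}

/-- `S = L ^ (1/2)`: the operator `S` is self-adjoint and positive, and `S ∘ S = L` as unbounded
operators, domains included. For a positive self-adjoint `L` there is exactly one such `S`. -/
structure IsPositiveSqrt [CompleteSpace H] (S L : H →ₗ.[ℂ] H) : Prop where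
  selfAdjoint : IsSelfAdjoint S
  nonneg : ∀ x ∈ S.domain, 0 ≤ (⟪x, app S x⟫_ℂ).re
  mem_domain_iff : ∀ x, x ∈ L.domain ↔ x ∈ S.domain ∧ app S x ∈ S.domain
  app_app : ∀ x ∈ L.domain, app L x = app S (app S x)

/-- The bounded operator `T` with `⟪ψ, T ψ⟫ = q ψ` for all `ψ ∈ D` (unique if `D` is dense);
`0` if there is none. -/
def opOfForm (D : Submodule ℂ H) (q : H → ℂ) : H →L[ℂ] H :=
  open Classical in
  if h : ∃ T : H →L[ℂ] H, ∀ ψ ∈ D, ⟪ψ, T ψ⟫_ℂ = q ψ then h.choose else 0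

/-! ### The operator associated with a positive quadratic form -/

/-- Sesquilinear form (conjugate-linear in `χ`) obtained from a positive quadratic form `q` by
polarization; it is meaningful where `q` is finite. -/
def polar (q : H → ENNReal) (χ ψ : H) : ℂ :=
  (1 / 4 : ℂ) * ∑ k ∈ Finset.range 4, Complex.I ^ k * ((q (ψ + Complex.I ^ k • χ)).toReal : ℂ)

/-- Domain of the operator `C` associated with the positive quadratic form `q`, where `q = ∞`
outside of the form domain: `ψ ∈ dom C` and `C ψ = φ` if and only if `q ψ < ∞` and
`q(χ, ψ) = ⟪χ, φ⟫` for all `χ` in the form domain. -/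
def opDomain (q : H → ENNReal) : Set H :=
  {ψ | q ψ < ⊤ ∧ ∃ φ : H, ∀ χ, q χ < ⊤ → polar q χ ψ = ⟪χ, φ⟫_ℂ}

/-! ### Ultraweak continuity -/

/-- Ultraweak continuity on `[0, ∞)` of an operator-valued function: continuity of all the
functionals `X ↦ ∑ₙ ⟪uₙ, X vₙ⟫` with `∑ ‖uₙ‖² < ∞`, `∑ ‖vₙ‖² < ∞`. -/
def UltraweaklyContinuous (X : ℝ → H →L[ℂ] H) : Prop :=
  ∀ u v : ℕ → H, Summable (fun n => ‖u n‖ ^ 2) → Summable (fun n => ‖v n‖ ^ 2) →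
    ContinuousOn (fun t => ∑' n, ⟪u n, X t (v n)⟫_ℂ) (Set.Ici 0)

/-! ### The Markov master equation -/

/-- The objects entering the Markov master equation
`∂ₜ P_{τ,t}(B) = Φₜ(P_{τ,t}(B)) - Gₜ* P_{τ,t}(B) - P_{τ,t}(B) Gₜ`, `Gₜ = Φₜ(I)/2 + i Hₜ`.
The unbounded completely positive map `Φₜ` is given through the map
`A t = L^{-1/2} Φₜ(·) L^{-1/2}` of bounded operators, that is
`Φₜ(X)[χ, ψ] = ⟪L^{1/2} χ, A t X (L^{1/2} ψ)⟫`. -/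
structure Data (H : Type*) [NormedAddCommGroup H] [InnerProductSpace ℂ H] [CompleteSpace H] where
  /-- the dominating operator `Λ` -/
  L : H →ₗ.[ℂ] H
  /-- its square root `Λ^{1/2}` -/
  sqrtL : H →ₗ.[ℂ] H
  /-- `A t = Λ^{-1/2} Φₜ(·) Λ^{-1/2}` -/
  A : ℝ → CompletelyPositiveMap (H →L[ℂ] H) (H →L[ℂ] H)
  /-- the Hamiltonians `Hₜ` -/
  Ham : ℝ → H →ₗ.[ℂ] H
  /-- the operators `Gₜ` -/
  G : ℝ → H →ₗ.[ℂ] H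
  /-- the evolution system `W_{s,t}`, `0 ≤ s ≤ t` -/
  W : ℝ → ℝ → H →L[ℂ] H
  /-- the joint core -/
  D : Submodule ℂ H
  /-- the exponent for which the core is contained in `dom Gₜ ^ N` -/
  N : ℕ

namespace Data

variable [CompleteSpace H] (M : Data H)

/-- The sesquilinear form `Φₜ(X)[χ, ψ]`, `χ, ψ ∈ dom Λ^{1/2}`. -/
def phi (t : ℝ) (X : H →L[ℂ] H) (χ ψ : H) : ℂ :=
  ⟪app M.sqrtL χ, M.A t X (app M.sqrtL ψ)⟫_ℂ

/-- The sequence `K k t` is a Kraus decomposition of `A t`, `t ≥ 0`: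
`A t X = ∑ₖ (K k t)* X (K k t)`. Then `Φₜ(X) = ∑ₖ Φₖ(t)* X Φₖ(t)` with `Φₖ(t) = K k t Λ^{1/2}`. -/
def IsKraus (K : ℕ → ℝ → H →L[ℂ] H) : Prop :=
  ∀ t, 0 ≤ t → ∀ (X : H →L[ℂ] H) (φ χ : H),
    HasSum (fun k => ⟪K k t φ, X (K k t χ)⟫_ℂ) ⟪φ, M.A t X χ⟫_ℂ

/-- The domain and continuity assumptions on the master equation. -/
structure Assumptions : Prop where
  -- `W` is a strongly continuous contractive evolution system
  W_self : ∀ t, 0 ≤ t → M.W t t = 1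
  W_comp : ∀ s r t, 0 ≤ s → s ≤ r → r ≤ t → M.W s r ∘L M.W r t = M.W s t
  W_contr : ∀ s t, 0 ≤ s → s ≤ t → ‖M.W s t‖ ≤ 1
  W_cont : ∀ ψ : H, ContinuousOn (fun p : ℝ × ℝ => M.W p.1 p.2 ψ) {p | 0 ≤ p.1 ∧ p.1 ≤ p.2}
  -- the generators: densely defined closed operators with the joint core `D ⊆ dom Gₜ ^ N`
  G_dense : ∀ t, 0 ≤ t → Dense ((M.G t).domain : Set H)
  G_closed : ∀ t, 0 ≤ t → (M.G t).IsClosed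
  G_core : ∀ t, 0 ≤ t → (M.G t).HasCore M.D
  two_le_N : 2 ≤ M.N
  D_domPow : ∀ t, 0 ≤ t → (M.D : Set H) ⊆ domPow (M.G t) M.N
  W_mem : ∀ s t, 0 ≤ s → s ≤ t → ∀ ψ ∈ M.D, M.W s t ψ ∈ M.D
  -- `∂ₜ W_{s,t} = - W_{s,t} Gₜ` and `∂ₛ W_{s,t} = Gₛ W_{s,t}` on the core
  W_deriv_right : ∀ s t, 0 ≤ s → s ≤ t → ∀ ψ ∈ M.D,
    HasDerivWithinAt (fun r => M.W s r ψ) (-(M.W s t (app (M.G t) ψ))) (Set.Ici s) t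
  W_deriv_left : ∀ s t, 0 ≤ s → s ≤ t → ∀ ψ ∈ M.D,
    HasDerivWithinAt (fun r => M.W r t ψ) (app (M.G s) (M.W s t ψ)) (Set.Icc 0 t) s
  -- the positive self-adjoint operator `Λ`
  L_selfAdjoint : IsSelfAdjoint M.L
  sqrtL_sqrt : IsPositiveSqrt M.sqrtL M.L
  -- `Λ ≥ Φₜ(I) ≥ I`, in the sense of forms on `dom Λ^{1/2}`
  phi_le : ∀ t, 0 ≤ t → ∀ ψ ∈ M.sqrtL.domain, (M.phi t 1 ψ ψ).re ≤ ‖app M.sqrtL ψ‖ ^ 2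
  le_phi : ∀ t, 0 ≤ t → ∀ ψ ∈ M.sqrtL.domain, ‖ψ‖ ^ 2 ≤ (M.phi t 1 ψ ψ).re
  -- the core lies in the form domain
  D_le : M.D ≤ M.sqrtL.domain
  -- `Gₜ* + Gₜ = Φₜ(I)` on the core
  D_le_adjoint : ∀ t, 0 ≤ t → M.D ≤ (M.G t).adjoint.domain
  adjoint_add : ∀ t, 0 ≤ t → ∀ χ ∈ M.D, ∀ ψ ∈ M.D,
    ⟪χ, app (M.G t).adjoint ψ + app (M.G t) ψ⟫_ℂ = M.phi t 1 χ ψ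
  -- `Gₜ = Φₜ(I) / 2 + i Hₜ` on the core, with a densely defined symmetric `Hₜ`
  Ham_dense : ∀ t, 0 ≤ t → Dense ((M.Ham t).domain : Set H)
  Ham_symm : ∀ t, 0 ≤ t → (M.Ham t).IsFormalAdjoint (M.Ham t)
  D_le_Ham : ∀ t, 0 ≤ t → M.D ≤ (M.Ham t).domain
  G_eq : ∀ t, 0 ≤ t → ∀ χ ∈ M.D, ∀ ψ ∈ M.D,
    ⟪χ, app (M.G t) ψ⟫_ℂ
      = (1 / 2 : ℂ) * M.phi t 1 χ ψ + Complex.I * ⟪χ, app (M.Ham t) ψ⟫_ℂ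
  -- the CP-maps `A t` are bounded, normal and ultraweakly continuous in `t`
  A_bounded : ∃ C : ℝ, ∀ t, 0 ≤ t → ∀ X, ‖M.A t X‖ ≤ C * ‖X‖
  A_normal : ∀ t, 0 ≤ t → ScottContinuous (M.A t)
  A_cont : ∀ X, UltraweaklyContinuous (fun t => M.A t X)
  -- `Λ^{1/2} W_{s,t} ψ` is `L²` in `s` and norm-continuous in `t`
  memLp : ∀ t, 0 ≤ t → ∀ ψ ∈ M.D,
    MeasureTheory.MemLp (fun s => app M.sqrtL (M.W s t ψ)) 2
      (MeasureTheory.volume.restrict (Set.Icc 0 t))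
  norm_cont : ∀ s, 0 ≤ s → ∀ ψ ∈ M.D,
    ContinuousOn (fun t => app M.sqrtL (M.W s t ψ)) (Set.Ici s)
  -- the same for `Λ^{1/2} Φₖ(s) W_{s,t} ψ`, for some Kraus decomposition with
  -- `D ⊆ dom Λ^{1/2} Φₖ(t)`
  kraus : ∃ K : ℕ → ℝ → H →L[ℂ] H, M.IsKraus K ∧ ∀ k,
    (∀ t, 0 ≤ t → ∀ ψ ∈ M.D, K k t (app M.sqrtL ψ) ∈ M.sqrtL.domain) ∧
    (∀ t, 0 ≤ t → ∀ ψ ∈ M.D,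
      MeasureTheory.MemLp (fun s => app M.sqrtL (K k s (app M.sqrtL (M.W s t ψ)))) 2
        (MeasureTheory.volume.restrict (Set.Icc 0 t))) ∧
    (∀ s, 0 ≤ s → ∀ ψ ∈ M.D,
      ContinuousOn (fun t => app M.sqrtL (K k s (app M.sqrtL (M.W s t ψ)))) (Set.Ici s))

/-- `V_{τ,t}(B) = W_{τ,t}* B W_{τ,t}`. -/
def V (τ t : ℝ) (B : H →L[ℂ] H) : H →L[ℂ] H :=
  (M.W τ t).adjoint ∘L B ∘L M.W τ t

/-- The iterations `P⁽⁰⁾_{τ,t}(B) = V_{τ,t}(B)`,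
`P⁽ⁿ⁺¹⁾_{τ,t}(B) = V_{τ,t}(B) + ∫_τ^t V_{s,t} Φₛ P⁽ⁿ⁾_{τ,s}(B) ds`, where the right-hand side is a
quadratic form on the core. -/
def iter : ℕ → ℝ → ℝ → (H →L[ℂ] H) → (H →L[ℂ] H)
  | 0, τ, t, B => M.V τ t B
  | n + 1, τ, t, B => opOfForm M.D fun ψ =>
      ⟪ψ, M.V τ t B ψ⟫_ℂ
        + ∫ s in τ..t, M.phi s (iter n τ s B) (M.W s t ψ) (M.W s t ψ)

/-- The minimal solution `P^min_{τ,t}(B) = l.u.b. P⁽ⁿ⁾_{τ,t}(B)` for bounded positive `B`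
(least upper bound in the order of operators). -/
def pMin (τ t : ℝ) (B : H →L[ℂ] H) : H →L[ℂ] H :=
  open Classical in
  if h : ∃ T, IsLUB (Set.range fun n => M.iter n τ t B) T then h.choose else 0

/-- The bounded positive operators `X ≤ Φₛ(I)`. -/
def minorants (s : ℝ) : Set (H →L[ℂ] H) :=
  {X | 0 ≤ X ∧ ∀ ψ ∈ M.D, (⟪ψ, X ψ⟫_ℂ).re ≤ (M.phi s 1 ψ ψ).re}

/-- The quadratic form, with values in `[0, ∞]`, of `P^min_{s,t} Φₛ(I)`: the value of the normal
positive map `P^min_{s,t}` at the unbounded positive operator `Φₛ(I)` is the supremum of its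
values at the bounded positive operators below `Φₛ(I)`. -/
def pMinPhi (s t : ℝ) (ψ : H) : ENNReal :=
  ⨆ X ∈ M.minorants s, ENNReal.ofReal (⟪ψ, M.pMin s t X ψ⟫_ℂ).re

/-- The quadratic form of `∫_τ^t P^min_{s,t} Φₛ(I) ds`. -/
def intForm (τ t : ℝ) (ψ : H) : ENNReal :=
  ∫⁻ s in Set.Icc τ t, M.pMinPhi s t ψ

end Data

end MarkovMaster

end

/-! The defects `I - P⁽ᵏ⁾_{τ,t}(I)` are positive and decrease in `k`, and each dominates `I -
P^min_{τ,t}(I)`. Hence `(n+1)(I - P^min_{τ,t}(I)) ≤ Sₙ(τ,t)`, where `Sₙ = ∑_{k≤n} (I - P⁽ᵏ⁾(I))`. If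
`Sₙ` is bounded by the form `∫_τ^t P^min_{s,t} Φₛ(I) ds` for every `n`, then the defect of `P^min`
vanishes at each vector where this form is finite, and density finishes the proof.

The bound comes from the identity `Sₙ(τ,t) = ∫_τ^t P⁽ⁿ⁾_{s,t} Φₛ(I) ds`. The relation `Gₜ* + Gₜ =
Φₜ(I)` gives `I = V_{τ,t}(I) + ∫_τ^t V_{s,t} Φₛ(I) ds` (`integral_flux_one`), so that `Sₙ₊₁(τ,t) =
S₀(τ,t) + ∫_τ^t V_{r,t} Φ_r(Sₙ(τ,r)) dr` with `S₀ = ∫ V_{s,t} Φₛ(I) ds` (`qf_defectSum_succ`).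
Tonelli on the triangle `τ ≤ s ≤ r ≤ t` shows that the right-hand side of the identity obeys the
same recursion (`ofReal_qf_defectSum`).

Three difficulties make up the rest. Since `Φₛ(I)` is unbounded, it is replaced by bounded Moreau
regularizations that increase to it on the core (`exists_minorants`). Tonelli needs joint
measurability of `P⁽ⁿ⁾_{s,r}(X_s)`, which is reduced to vectors by a Kraus decomposition
(`exists_kraus_vectors`, `measurable_qf_clampIter`). The Kraus vectors need not lie in the core, so
at each induction step the identity is extended from the core to all vectors
(`ofReal_qf_eq_iSup_of_dense`). -/

noncomputable section

set_option linter.unusedSectionVars false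

open scoped InnerProductSpace ENNReal ComplexOrder
open MeasureTheory Filter Topology

namespace MarkovMaster

variable {H : Type*} [NormedAddCommGroup H] [InnerProductSpace ℂ H]

section

/-! ### Quadratic forms of bounded operators -/

/-- The real quadratic form of a bounded operator. -/
def qf (X : H →L[ℂ] H) (ψ : H) : ℝ := (⟪ψ, X ψ⟫_ℂ).re

lemma qf_add (X Y : H →L[ℂ] H) (ψ : H) : qf (X + Y) ψ = qf X ψ + qf Y ψ := by
  simp [qf]

lemma qf_sub (X Y : H →L[ℂ] H) (ψ : H) : qf (X - Y) ψ = qf X ψ - qf Y ψ := by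
  simp [qf]

lemma qf_one (ψ : H) : qf (1 : H →L[ℂ] H) ψ = ‖ψ‖ ^ 2 := by
  simp only [qf, one_apply_eq_self]
  exact inner_self_eq_norm_sq (𝕜 := ℂ) ψ

lemma qf_zero_op (ψ : H) : qf (0 : H →L[ℂ] H) ψ = 0 := by simp [qf]

lemma qf_sum {ι : Type*} (s : Finset ι) (X : ι → H →L[ℂ] H) (ψ : H) :
    qf (∑ i ∈ s, X i) ψ = ∑ i ∈ s, qf (X i) ψ := by
  classical
  induction s using Finset.induction_on with
  | empty => simp [qf_zero_op]
  | insert a s ha ih => rw [Finset.sum_insert ha, Finset.sum_insert ha, qf_add, ih]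

lemma continuous_qf (X : H →L[ℂ] H) : Continuous (qf X) := by
  unfold qf; fun_prop

lemma qf_le_norm (X : H →L[ℂ] H) (ψ : H) : qf X ψ ≤ ‖X‖ * ‖ψ‖ ^ 2 := by
  calc qf X ψ ≤ ‖⟪ψ, X ψ⟫_ℂ‖ := Complex.re_le_norm _
    _ ≤ ‖ψ‖ * ‖X ψ‖ := norm_inner_le_norm _ _
    _ ≤ ‖ψ‖ * (‖X‖ * ‖ψ‖) := by gcongr; exact X.le_opNorm _
    _ = _ := by ring

lemma abs_qf_sub_qf_le (X : H →L[ℂ] H) (ψ φ : H) :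
    |qf X ψ - qf X φ| ≤ ‖X‖ * (‖ψ‖ + ‖φ‖) * ‖ψ - φ‖ := by
  have h : qf X ψ - qf X φ = (⟪ψ, X (ψ - φ)⟫_ℂ + ⟪ψ - φ, X φ⟫_ℂ).re := by
    simp [qf]

  rw [h]
  calc |(⟪ψ, X (ψ - φ)⟫_ℂ + ⟪ψ - φ, X φ⟫_ℂ).re|
      ≤ ‖⟪ψ, X (ψ - φ)⟫_ℂ + ⟪ψ - φ, X φ⟫_ℂ‖ := Complex.abs_re_le_norm _
    _ ≤ ‖ψ‖ * ‖X (ψ - φ)‖ + ‖ψ - φ‖ * ‖X φ‖ :=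
        (norm_add_le _ _).trans (add_le_add (norm_inner_le_norm _ _) (norm_inner_le_norm _ _))
    _ ≤ ‖ψ‖ * (‖X‖ * ‖ψ - φ‖) + ‖ψ - φ‖ * (‖X‖ * ‖φ‖) := by
        gcongr <;> exact X.le_opNorm _
    _ = _ := by ring

variable [CompleteSpace H]

lemma inner_eq_qf {X : H →L[ℂ] H} (hX : 0 ≤ X) (ψ : H) : ⟪ψ, X ψ⟫_ℂ = (qf X ψ : ℂ) := by
  have h := ((ContinuousLinearMap.nonneg_iff_isPositive X).1 hX).inner_nonneg_right ψ
  exact Complex.ext rfl (Complex.le_def.1 h).2.symm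

lemma qf_nonneg {X : H →L[ℂ] H} (hX : 0 ≤ X) (ψ : H) : 0 ≤ qf X ψ :=
  ((ContinuousLinearMap.nonneg_iff_isPositive X).1 hX).re_inner_nonneg_right ψ

lemma qf_mono {X Y : H →L[ℂ] H} (h : X ≤ Y) (ψ : H) : qf X ψ ≤ qf Y ψ := by
  have := qf_nonneg (sub_nonneg.2 h) ψ
  rw [qf_sub] at this; linarith

/-- On a complex space a real quadratic form forces the operator to be symmetric. The existential
therefore encodes both the reality and the sign of the value, and both survive passage to the
closure. -/
lemma nonneg_of_forall_mem_dense {D : Set H} (hD : Dense D) {X : H →L[ℂ] H}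
    (h : ∀ ψ ∈ D, ∃ c : ℝ, 0 ≤ c ∧ ⟪ψ, X ψ⟫_ℂ = c) : 0 ≤ X := by
  have hcl : IsClosed {ψ : H | 0 ≤ ⟪ψ, X ψ⟫_ℂ} :=
    isClosed_le continuous_const (by fun_prop)
  have hall : ∀ ψ, 0 ≤ ⟪ψ, X ψ⟫_ℂ := fun ψ => by
    refine hcl.closure_subset_iff.2 (fun φ hφ => ?_) (hD ψ)
    obtain ⟨c, hc, e⟩ := h φ hφ
    show 0 ≤ ⟪φ, X φ⟫_ℂ
    rw [e]; exact_mod_cast hc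
  rw [ContinuousLinearMap.nonneg_iff_isPositive, ContinuousLinearMap.isPositive_iff_complex]
  intro ψ
  have h1 := Complex.le_def.1 (hall ψ)
  have e : ⟪ψ, X ψ⟫_ℂ = ((⟪ψ, X ψ⟫_ℂ).re : ℂ) := Complex.ext rfl (by simpa using h1.2.symm)
  have e' : ⟪X ψ, ψ⟫_ℂ = ⟪ψ, X ψ⟫_ℂ := by
    rw [← inner_conj_symm (X ψ) ψ, e, Complex.conj_ofReal]
  rw [e']
  exact ⟨e.symm, h1.1⟩

lemma le_of_forall_mem_dense {D : Set H} (hD : Dense D) {X Y : H →L[ℂ] H} (hX : 0 ≤ X)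
    (hY : 0 ≤ Y) (h : ∀ ψ ∈ D, qf X ψ ≤ qf Y ψ) : X ≤ Y := by
  rw [← sub_nonneg]
  refine nonneg_of_forall_mem_dense hD fun ψ hψ => ⟨qf Y ψ - qf X ψ, sub_nonneg.2 (h ψ hψ), ?_⟩
  simp [inner_eq_qf hX, inner_eq_qf hY]

lemma le_of_qf_le {X Y : H →L[ℂ] H} (hX : 0 ≤ X) (hY : 0 ≤ Y) (h : ∀ ψ, qf X ψ ≤ qf Y ψ) :
    X ≤ Y :=
  le_of_forall_mem_dense dense_univ hX hY fun ψ _ => h ψ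

lemma norm_le_of_qf_le {X : H →L[ℂ] H} (hX : 0 ≤ X) {c : ℝ} (hc : 0 ≤ c)
    (h : ∀ ψ, qf X ψ ≤ c * ‖ψ‖ ^ 2) : ‖X‖ ≤ c := by
  rw [CStarAlgebra.norm_le_iff_le_algebraMap X hc hX]
  have e : ∀ ψ, qf (algebraMap ℝ (H →L[ℂ] H) c) ψ = c * ‖ψ‖ ^ 2 := fun ψ => by
    rw [← qf_one, Algebra.algebraMap_eq_smul_one]
    simp only [qf, smul_apply, one_apply_eq_self]
    rw [← Complex.coe_smul, inner_smul_right, Complex.re_ofReal_mul]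
  refine le_of_qf_le hX ?_ fun ψ => by rw [e]; exact h ψ
  exact algebraMap_nonneg _ hc

lemma opOfForm_apply {D : Submodule ℂ H} {q : H → ℂ}
    (h : ∃ T : H →L[ℂ] H, ∀ ψ ∈ D, ⟪ψ, T ψ⟫_ℂ = q ψ) {ψ : H} (hψ : ψ ∈ D) :
    ⟪ψ, opOfForm D q ψ⟫_ℂ = q ψ := by
  unfold opOfForm
  rw [dif_pos h]
  exact h.choose_spec ψ hψ

/-- A bounded sesquilinear form on a dense subspace is the form of a bounded operator. -/
lemma exists_op_of_sesq {D : Submodule ℂ H} (hD : Dense (D : Set H))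
    (b : D → D → ℂ) (hadd_l : ∀ x y z, b (x + y) z = b x z + b y z)
    (hsmul_l : ∀ (c : ℂ) x z, b (c • x) z = starRingEnd ℂ c * b x z)
    (hadd_r : ∀ x y z, b x (y + z) = b x y + b x z)
    (hsmul_r : ∀ (c : ℂ) x z, b x (c • z) = c * b x z)
    {C : ℝ} (hC : ∀ x y, ‖b x y‖ ≤ C * ‖x‖ * ‖y‖) :
    ∃ T : H →L[ℂ] H, ∀ x y : D, ⟪(x : H), T y⟫_ℂ = b x y := by
  have hr : DenseRange (D.subtype : D → H) := by simpa [DenseRange] using hD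
  let f : D → D →ₗ[ℂ] ℂ := fun x =>
    { toFun := b x, map_add' := hadd_r x, map_smul' := fun c z => hsmul_r c x z }
  have hf : ∀ x y, ‖f x y‖ ≤ C * ‖x‖ * ‖D.subtype y‖ := fun x y => hC x y
  let F : D → H →L[ℂ] ℂ := fun x => (f x).extendOfNorm D.subtype
  have hF : ∀ x y : D, F x y = b x y := fun x y =>
    LinearMap.extendOfNorm_eq (f := f x) (e := D.subtype) hr ⟨_, hf x⟩ y
  let g : D →ₗ[ℂ] H :=
    { toFun := fun x => (InnerProductSpace.toDual ℂ H).symm (F x)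
      map_add' := fun x y => hD.eq_of_inner_left ℂ fun z hz => by
        have := fun x => hF x ⟨z, hz⟩
        simp only at this
        simp [InnerProductSpace.toDual_symm_apply, inner_add_left, this, hadd_l]
      map_smul' := fun c x => hD.eq_of_inner_left ℂ fun z hz => by
        have := fun x => hF x ⟨z, hz⟩
        simp only at this
        simp [InnerProductSpace.toDual_symm_apply, inner_smul_left, this, hsmul_l] }
  have hg : ∀ x y : D, ⟪g x, (y : H)⟫_ℂ = b x y := fun x y => by
    simp only [g, LinearMap.coe_mk, AddHom.coe_mk, InnerProductSpace.toDual_symm_apply]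
    exact hF x y
  have hgn : ∀ x : D, ‖g x‖ ≤ max C 0 * ‖D.subtype x‖ := fun x => by
    have h0 : 0 ≤ max C 0 * ‖x‖ := by positivity
    simp only [g, LinearMap.coe_mk, AddHom.coe_mk, LinearIsometryEquiv.norm_map]
    refine LinearMap.opNorm_extendOfNorm_le (f := f x) (e := D.subtype) hr h0 fun y => ?_
    refine (hf x y).trans ?_
    gcongr
    · exact le_max_left _ _
    · exact le_rfl
  let T₀ : H →L[ℂ] H := g.extendOfNorm D.subtype
  have hT₀ : ∀ x : D, T₀ x = g x := fun x =>
    LinearMap.extendOfNorm_eq (f := g) (e := D.subtype) hr ⟨_, hgn⟩ x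
  refine ⟨T₀.adjoint, fun x y => ?_⟩
  rw [ContinuousLinearMap.adjoint_inner_right, hT₀, hg]

/-- Cauchy–Schwarz for positive semidefinite sesquilinear forms. -/
lemma norm_sesq_le {V : Type*} [NormedAddCommGroup V] [NormedSpace ℂ V] (b : V → V → ℂ)
    (hadd_l : ∀ x y z, b (x + y) z = b x z + b y z)
    (hsmul_l : ∀ (c : ℂ) x z, b (c • x) z = starRingEnd ℂ c * b x z)
    (hsymm : ∀ x y, starRingEnd ℂ (b y x) = b x y)
    (hpos : ∀ x, 0 ≤ (b x x).re) {C : ℝ} (hb : ∀ x, (b x x).re ≤ C * ‖x‖ ^ 2) (x y : V) :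
    ‖b x y‖ ≤ C * ‖x‖ * ‖y‖ := by
  let core : PreInnerProductSpace.Core ℂ V :=
    { inner := b
      conj_inner_symm := fun x y => hsymm x y
      re_inner_nonneg := hpos
      add_left := hadd_l
      smul_left := fun x y c => hsmul_l c x y }
  have h : ‖b x y‖ * ‖b y x‖ ≤ (b x x).re * (b y y).re :=
    InnerProductSpace.Core.inner_mul_inner_self_le (c := core) x y
  have e : ‖b y x‖ = ‖b x y‖ := by rw [← hsymm x y, Complex.norm_conj]
  rw [e] at h
  rcases eq_or_ne x 0 with rfl | hx
  · have : b 0 y = 0 := by simpa using hsmul_l 0 0 y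
    simp [this]
  have hC : 0 ≤ C := by
    have := (hpos x).trans (hb x)
    have hx' : 0 < ‖x‖ ^ 2 := by positivity
    exact nonneg_of_mul_nonneg_left this hx'
  refine le_of_sq_le_sq (a := ‖b x y‖) ?_ (by positivity)
  calc ‖b x y‖ ^ 2 = ‖b x y‖ * ‖b x y‖ := sq _
    _ ≤ _ := h
    _ ≤ (C * ‖x‖ ^ 2) * (C * ‖y‖ ^ 2) := mul_le_mul (hb x) (hb y) (hpos y) (by positivity)
    _ = _ := by ring

/-- A bounded increasing sequence of positive operators has a least upper bound. -/
lemma exists_isLUB_of_monotone {X : ℕ → H →L[ℂ] H} (hmono : Monotone X) (h0 : ∀ n, 0 ≤ X n)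
    {c : ℝ} (hc : ∀ n ψ, qf (X n) ψ ≤ c * ‖ψ‖ ^ 2) : ∃ T, IsLUB (Set.range X) T := by
  have hc0 : ∀ n ψ, qf (X n) ψ ≤ max c 0 * ‖ψ‖ ^ 2 := fun n ψ =>
    (hc n ψ).trans (by gcongr; exact le_max_left _ _)
  have hlim : ∀ ψ, ∃ l, Tendsto (fun n => X n ψ) atTop (𝓝 l) := by
    intro ψ
    apply cauchySeq_tendsto_of_complete
    have hq : CauchySeq fun n => qf (X n) ψ := by
      have : Tendsto (fun n => qf (X n) ψ) atTop (𝓝 (⨆ n, qf (X n) ψ)) :=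
        tendsto_atTop_ciSup (fun m n hmn => qf_mono (hmono hmn) ψ)
          ⟨c * ‖ψ‖ ^ 2, by rintro _ ⟨n, rfl⟩; exact hc n ψ⟩
      exact this.cauchySeq
    -- Convergence of the forms is upgraded to strong convergence. With `Y = X n - X m ≥ 0`,
    -- Cauchy–Schwarz for `⟪·, Y ·⟫` at `ψ` and `Y ψ` gives `‖Yψ‖⁴ ≤ qf Y ψ * qf Y (Yψ)`, and the
    -- last factor is at most `max c 0 * ‖Yψ‖²`.
    have key : ∀ m n, m ≤ n → ‖X n ψ - X m ψ‖ ^ 2 ≤ max c 0 * (qf (X n) ψ - qf (X m) ψ) := by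
      intro m n hmn
      have hp : 0 ≤ X n - X m := sub_nonneg.2 (hmono hmn)
      have hps := (ContinuousLinearMap.nonneg_iff_isPositive _).1 hp
      set Y := X n - X m with hY
      have hYb : ∀ φ, qf Y φ ≤ max c 0 * ‖φ‖ ^ 2 := fun φ => by
        rw [hY, qf_sub]; linarith [hc0 n φ, qf_nonneg (h0 m) φ]
      let core : PreInnerProductSpace.Core ℂ H :=
        { inner := fun x y => ⟪x, Y y⟫_ℂ
          conj_inner_symm := fun x y => by
            rw [inner_conj_symm, hps.inner_left_eq_inner_right]
          re_inner_nonneg := fun x => qf_nonneg hp x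
          add_left := fun x y z => inner_add_left _ _ _
          smul_left := fun x y c => inner_smul_left _ _ _ }
      have h : ‖⟪ψ, Y (Y ψ)⟫_ℂ‖ * ‖⟪Y ψ, Y ψ⟫_ℂ‖ ≤ qf Y ψ * qf Y (Y ψ) :=
        InnerProductSpace.Core.inner_mul_inner_self_le (c := core) ψ (Y ψ)
      rw [← hps.inner_left_eq_inner_right, inner_self_eq_norm_sq_to_K] at h
      have e : ‖((‖Y ψ‖ : ℂ)) ^ 2‖ = ‖Y ψ‖ ^ 2 := by simp
      erw [e] at h
      have h2 := h.trans (mul_le_mul_of_nonneg_left (hYb (Y ψ)) (qf_nonneg hp ψ))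
      have e2 : X n ψ - X m ψ = Y ψ := by simp [hY]
      rw [e2, ← qf_sub, ← hY]
      rcases (sq_nonneg ‖Y ψ‖).eq_or_lt with h3 | h3
      · rw [← h3]; exact mul_nonneg (le_max_right _ _) (qf_nonneg hp ψ)
      · refine le_of_mul_le_mul_right ?_ h3
        linarith
    rw [Metric.cauchySeq_iff'] at hq ⊢
    intro ε hε
    obtain ⟨N, hN⟩ := hq (ε ^ 2 / (max c 0 + 1)) (by positivity)
    refine ⟨N, fun n hn => ?_⟩
    have h1 := hN n hn
    rw [Real.dist_eq] at h1
    have h2 := key N n hn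
    have h3 := (abs_lt.1 h1).2
    rw [dist_eq_norm]
    refine lt_of_pow_lt_pow_left₀ 2 hε.le (h2.trans_lt ?_)
    have hm : (0 : ℝ) ≤ max c 0 := le_max_right _ _
    have h4 : qf (X n) ψ - qf (X N) ψ < ε ^ 2 / (max c 0 + 1) := h3
    rw [lt_div_iff₀ (by positivity)] at h4
    have h5 : 0 ≤ qf (X n) ψ - qf (X N) ψ := sub_nonneg.2 (qf_mono (hmono hn) ψ)
    nlinarith
  choose f hf using hlim
  have hT : Tendsto (fun n x => X n x) atTop (𝓝 f) := tendsto_pi_nhds.2 hf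
  let T : H →L[ℂ] H := continuousLinearMapOfTendsto X hT
  have hq : ∀ ψ, Tendsto (fun n => ⟪ψ, X n ψ⟫_ℂ) atTop (𝓝 ⟪ψ, T ψ⟫_ℂ) := fun ψ =>
    tendsto_const_nhds.inner (hf ψ)
  have hnonneg : ∀ {U : H →L[ℂ] H} {Z : ℕ → H →L[ℂ] H}, (∀ᶠ n in atTop, 0 ≤ Z n) →
      (∀ ψ, Tendsto (fun n => ⟪ψ, Z n ψ⟫_ℂ) atTop (𝓝 ⟪ψ, U ψ⟫_ℂ)) → 0 ≤ U := by
    intro U Z hZ hZU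
    refine nonneg_of_forall_mem_dense dense_univ fun ψ _ => ?_
    have h1 : 0 ≤ ⟪ψ, U ψ⟫_ℂ := ge_of_tendsto (hZU ψ) (hZ.mono fun n hn =>
      ((ContinuousLinearMap.nonneg_iff_isPositive _).1 hn).inner_nonneg_right ψ)
    have h2 := Complex.le_def.1 h1
    exact ⟨_, h2.1, Complex.ext rfl (by simpa using h2.2.symm)⟩
  refine ⟨T, ?_, ?_⟩
  · rintro _ ⟨m, rfl⟩
    rw [← sub_nonneg]
    refine hnonneg (Z := fun n => X n - X m) ((eventually_ge_atTop m).mono fun n hn =>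
      sub_nonneg.2 (hmono hn)) fun ψ => ?_
    simpa [inner_sub_right] using (hq ψ).sub_const _
  · intro U hU
    rw [← sub_nonneg]
    refine hnonneg (Z := fun n => U - X n) (Eventually.of_forall fun n =>
      sub_nonneg.2 (hU ⟨n, rfl⟩)) fun ψ => ?_
    simpa [inner_sub_right] using (hq ψ).const_sub _

end

section

/-! ### Values of unbounded operators -/

lemma app_of_mem {T : H →ₗ.[ℂ] H} {x : H} (hx : x ∈ T.domain) : app T x = T ⟨x, hx⟩ := by
  simp [app, hx]

lemma app_add {T : H →ₗ.[ℂ] H} {x y : H} (hx : x ∈ T.domain) (hy : y ∈ T.domain) :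
    app T (x + y) = app T x + app T y := by
  rw [app_of_mem hx, app_of_mem hy, app_of_mem (T.domain.add_mem hx hy), ← LinearPMap.map_add]
  rfl

lemma app_smul {T : H →ₗ.[ℂ] H} (c : ℂ) {x : H} (hx : x ∈ T.domain) :
    app T (c • x) = c • app T x := by
  rw [app_of_mem hx, app_of_mem (T.domain.smul_mem c hx), ← LinearPMap.map_smul]
  rfl

lemma app_sub {T : H →ₗ.[ℂ] H} {x y : H} (hx : x ∈ T.domain) (hy : y ∈ T.domain) :
    app T (x - y) = app T x - app T y := by
  have := app_add hx (T.domain.smul_mem (-1) hy)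
  rw [app_smul _ hy] at this
  simpa [sub_eq_add_neg] using this

/-- A core of a densely defined closed operator is dense. -/
lemma dense_of_hasCore {T : H →ₗ.[ℂ] H} {D : Submodule ℂ H} (hd : Dense (T.domain : Set H))
    (hcl : T.IsClosed) (hD : T.HasCore D) : Dense (D : Set H) := by
  have hle : T.domRestrict D ≤ T := T.domRestrict_le
  have hclos : (T.domRestrict D).IsClosable := hcl.isClosable.leIsClosable hle
  have hg := hclos.graph_closure_eq_closure_graph
  rw [hD.closure_eq] at hg
  refine dense_iff_closure_eq.2 (Set.eq_univ_of_univ_subset ?_)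
  rw [← hd.closure_eq]
  refine closure_minimal (fun x hx => ?_) isClosed_closure
  have hmem : (x, T ⟨x, hx⟩) ∈ closure ((T.domRestrict D).graph : Set (H × H)) := by
    rw [← Submodule.topologicalClosure_coe, hg]
    exact T.mem_graph ⟨x, hx⟩
  refine (map_mem_closure continuous_fst hmem ?_ : (x, T ⟨x, hx⟩).1 ∈ _)
  rintro ⟨a, b⟩ hab
  obtain ⟨y, hy, -⟩ := (LinearPMap.mem_graph_iff _).1 hab
  have hmem : (y : H) ∈ D ⊓ T.domain := LinearPMap.domRestrict_domain T ▸ y.2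
  exact hy ▸ hmem.1

variable [CompleteSpace H]

/-- A self-adjoint operator that is bounded below has a continuous left inverse. -/
lemma exists_continuous_leftInverse {S : H →ₗ.[ℂ] H} (hS : IsSelfAdjoint S)
    (hb : ∀ x ∈ S.domain, ‖x‖ ≤ ‖app S x‖) :
    ∃ g : H → H, Continuous g ∧ ∀ x ∈ S.domain, g (app S x) = x := by
  have hd := hS.dense_domain
  have hadj : S.adjoint = S := LinearPMap.isSelfAdjoint_def.1 hS
  have hcl : IsClosed (S.graph : Set (H × H)) := by
    have := LinearPMap.adjoint_isClosed hd
    rwa [hadj] at this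
  let R : Submodule ℂ H := LinearMap.range S.toFun
  have hRmem : ∀ {y}, y ∈ R ↔ ∃ x ∈ S.domain, app S x = y := by
    intro y
    constructor
    · rintro ⟨x, rfl⟩
      exact ⟨x, x.2, app_of_mem x.2⟩
    · rintro ⟨x, hx, rfl⟩
      exact ⟨⟨x, hx⟩, (app_of_mem hx).symm⟩
  have hdist : ∀ x ∈ S.domain, ∀ y ∈ S.domain, ‖x - y‖ ≤ ‖app S x - app S y‖ := by
    intro x hx y hy
    rw [← app_sub hx hy]
    exact hb _ (S.domain.sub_mem hx hy)
  -- The lower bound makes preimages of a Cauchy sequence Cauchy, and the graph is closed.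
  have hRcl : IsClosed (R : Set H) := by
    rw [← isSeqClosed_iff_isClosed]
    intro y z hy hyz
    choose x hx hxy using fun n => hRmem.1 (hy n)
    have hcau : CauchySeq x := by
      have := hyz.cauchySeq
      rw [Metric.cauchySeq_iff] at this ⊢
      intro ε hε
      obtain ⟨N, hN⟩ := this ε hε
      refine ⟨N, fun m hm n hn => lt_of_le_of_lt ?_ (hN m hm n hn)⟩
      rw [dist_eq_norm, dist_eq_norm, ← hxy, ← hxy]
      exact hdist _ (hx m) _ (hx n)
    obtain ⟨x', hx'⟩ := cauchySeq_tendsto_of_complete hcau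
    have hm : (x', z) ∈ (S.graph : Set (H × H)) := by
      refine hcl.mem_of_tendsto (hx'.prodMk_nhds hyz) (Eventually.of_forall fun n => ?_)
      rw [← hxy n, app_of_mem (hx n)]
      exact S.mem_graph ⟨x n, hx n⟩
    obtain ⟨w, hw, hw2⟩ := (LinearPMap.mem_graph_iff _).1 hm
    exact ⟨w, hw2⟩
  -- A vector orthogonal to the range is in the domain of the adjoint and is sent to `0`.
  -- Self-adjointness and the lower bound then make it zero.
  have hRdense : Rᗮ = ⊥ := by
    rw [Submodule.eq_bot_iff]
    intro y hy
    have hy' : ∀ x : S.domain, ⟪(0 : H), x⟫_ℂ = ⟪y, S x⟫_ℂ := fun x => by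
      rw [inner_zero_left]
      exact ((Submodule.mem_orthogonal' R y).1 hy _ ⟨x, rfl⟩).symm
    have hyd : y ∈ S.adjoint.domain := LinearPMap.mem_adjoint_domain_of_exists y ⟨0, hy'⟩
    have h0 := LinearPMap.adjoint_apply_eq hd ⟨y, hyd⟩ hy'
    rw [← app_of_mem hyd, hadj] at h0
    rw [hadj] at hyd
    have := hb y hyd
    rw [h0, norm_zero] at this
    exact norm_le_zero_iff.1 this
  have hRtop : R = ⊤ := by
    have : R.topologicalClosure = ⊤ := (Submodule.topologicalClosure_eq_top_iff).2 hRdense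
    rwa [hRcl.submodule_topologicalClosure_eq] at this
  have hsurj : ∀ y, ∃ x ∈ S.domain, app S x = y := fun y => hRmem.1 (hRtop ▸ Submodule.mem_top)
  choose g hg hgy using hsurj
  have hlip : LipschitzWith 1 g := LipschitzWith.of_dist_le_mul fun y z => by
    rw [NNReal.coe_one, one_mul, dist_eq_norm, dist_eq_norm]
    simpa [hgy] using hdist _ (hg y) _ (hg z)
  refine ⟨g, hlip.continuous, fun x hx => ?_⟩
  have := hdist _ (hg (app S x)) _ hx
  rw [hgy, sub_self, norm_zero] at this
  exact sub_eq_zero.1 (norm_le_zero_iff.1 this)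

/-- Joint measurability of quadratic forms in the operator and the vector. -/
lemma measurable_qf_comp [TopologicalSpace.SeparableSpace H] {α : Type*} [MeasurableSpace α]
    {Y : α → H →L[ℂ] H} (hY : ∀ χ, Measurable fun a => qf (Y a) χ) {v : α → H}
    (hv : StronglyMeasurable v) : Measurable fun a => qf (Y a) (v a) := by
  borelize H
  have : SecondCountableTopology H := UniformSpace.secondCountable_of_separable H
  have h := measurable_uncurry_of_continuous_of_measurable (u := fun (χ : H) (a : α) => qf (Y a) χ)
    (fun a => continuous_qf (Y a)) hY
  exact h.comp (hv.measurable.prodMk measurable_id)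

/-! ### The flux of an operator family along the evolution. -/

namespace Data

variable (M : Data H)

/-- The density in `r` of the quadratic form of `∫ V_{r,t} Φ_r (Y_r) dr`. -/
def flux (t : ℝ) (ψ : H) (r : ℝ) (Y : H →L[ℂ] H) : ℝ :=
  (M.phi r Y (M.W r t ψ) (M.W r t ψ)).re

variable {M}

lemma flux_eq_qf (t : ℝ) (ψ : H) (r : ℝ) (Y : H →L[ℂ] H) :
    M.flux t ψ r Y = qf (M.A r Y) (app M.sqrtL (M.W r t ψ)) := rfl

lemma A_mono (r : ℝ) {X Y : H →L[ℂ] H} (h : X ≤ Y) : M.A r X ≤ M.A r Y :=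
  OrderHomClass.mono (M.A r) h

lemma A_nonneg (r : ℝ) {X : H →L[ℂ] H} (h : 0 ≤ X) : 0 ≤ M.A r X := by
  simpa using M.A_mono r h

lemma flux_nonneg (t : ℝ) (ψ : H) (r : ℝ) {Y : H →L[ℂ] H} (h : 0 ≤ Y) : 0 ≤ M.flux t ψ r Y :=
  qf_nonneg (M.A_nonneg r h) _

lemma flux_mono (t : ℝ) (ψ : H) (r : ℝ) {X Y : H →L[ℂ] H} (h : X ≤ Y) :
    M.flux t ψ r X ≤ M.flux t ψ r Y :=
  qf_mono (M.A_mono r h) _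

lemma flux_sub (t : ℝ) (ψ : H) (r : ℝ) (X Y : H →L[ℂ] H) :
    M.flux t ψ r (X - Y) = M.flux t ψ r X - M.flux t ψ r Y := by
  simp only [flux_eq_qf, map_sub, qf_sub]

lemma flux_sum (t : ℝ) (ψ : H) (r : ℝ) {ι : Type*} (s : Finset ι) (X : ι → H →L[ℂ] H) :
    M.flux t ψ r (∑ i ∈ s, X i) = ∑ i ∈ s, M.flux t ψ r (X i) := by
  simp only [flux_eq_qf, map_sum, qf_sum]

lemma phi_eq_flux (t : ℝ) (ψ : H) (r : ℝ) {Y : H →L[ℂ] H} (h : 0 ≤ Y) :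
    M.phi r Y (M.W r t ψ) (M.W r t ψ) = (M.flux t ψ r Y : ℂ) :=
  inner_eq_qf (M.A_nonneg r h) _

lemma le_smul_one {Y : H →L[ℂ] H} (h : 0 ≤ Y) {c : ℝ} (hc : 0 ≤ c)
    (hY : ∀ χ, qf Y χ ≤ c * ‖χ‖ ^ 2) : Y ≤ (c : ℂ) • (1 : H →L[ℂ] H) := by
  refine le_of_qf_le h ?_ fun χ => ?_
  · rw [ContinuousLinearMap.nonneg_iff_isPositive]
    exact ContinuousLinearMap.isPositive_one.smul_of_nonneg (by exact_mod_cast hc)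
  · refine (hY χ).trans (le_of_eq ?_)
    rw [← qf_one]
    simp only [qf, smul_apply, one_apply_eq_self]
    rw [inner_smul_right, Complex.re_ofReal_mul]

lemma flux_le (t : ℝ) (ψ : H) (r : ℝ) {Y : H →L[ℂ] H} (h : 0 ≤ Y) {c : ℝ} (hc : 0 ≤ c)
    (hY : ∀ χ, qf Y χ ≤ c * ‖χ‖ ^ 2) : M.flux t ψ r Y ≤ c * M.flux t ψ r 1 := by
  refine (M.flux_mono t ψ r (le_smul_one h hc hY)).trans (le_of_eq ?_)
  rw [flux_eq_qf, map_smul, flux_eq_qf]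
  simp only [qf, smul_apply]
  rw [inner_smul_right, Complex.re_ofReal_mul]

namespace Assumptions

variable (hM : M.Assumptions)
include hM

lemma dense_D : Dense (M.D : Set H) :=
  dense_of_hasCore (hM.G_dense 0 le_rfl) (hM.G_closed 0 le_rfl) (hM.G_core 0 le_rfl)

lemma norm_le_app {x : H} (hx : x ∈ M.sqrtL.domain) : ‖x‖ ≤ ‖app M.sqrtL x‖ := by
  have := (hM.le_phi 0 le_rfl x hx).trans (hM.phi_le 0 le_rfl x hx)
  exact le_of_sq_le_sq this (norm_nonneg _)

lemma W_mem_sqrt {r t : ℝ} (hr : 0 ≤ r) (hrt : r ≤ t) {ψ : H} (hψ : ψ ∈ M.D) :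
    M.W r t ψ ∈ M.sqrtL.domain :=
  hM.D_le (hM.W_mem r t hr hrt ψ hψ)

lemma W_comp_apply {s r t : ℝ} (hs : 0 ≤ s) (hsr : s ≤ r) (hrt : r ≤ t) (ψ : H) :
    M.W s r (M.W r t ψ) = M.W s t ψ := by
  rw [← hM.W_comp s r t hs hsr hrt]; rfl

lemma norm_W_le {s t : ℝ} (hs : 0 ≤ s) (hst : s ≤ t) (ψ : H) : ‖M.W s t ψ‖ ≤ ‖ψ‖ := by
  simpa using (M.W s t).le_of_opNorm_le (hM.W_contr s t hs hst) ψ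

/-- The flux through a vector of the core is a measurable sum of squares. -/
lemma exists_kraus_vectors {t : ℝ} (ht : 0 ≤ t) {ψ : H} (hψ : ψ ∈ M.D) :
    ∃ v : ℕ → ℝ → H, (∀ k, StronglyMeasurable (v k)) ∧
      ∀ᵐ r ∂(volume.restrict (Set.Icc 0 t)), ∀ Y : H →L[ℂ] H, 0 ≤ Y →
        ENNReal.ofReal (M.flux t ψ r Y) = ∑' k, ENNReal.ofReal (qf Y (v k r)) := by
  obtain ⟨K, hK, hK'⟩ := hM.kraus
  -- The assumptions give measurability of `Λ^{1/2} Φₖ(r) W_{r,t} ψ` only. Since `Λ ≥ I`, a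
  -- continuous left inverse of `Λ^{1/2}` recovers `Φₖ(r) W_{r,t} ψ` as a measurable function of
  -- `r`.
  obtain ⟨g, hg, hgS⟩ := exists_continuous_leftInverse hM.sqrtL_sqrt.selfAdjoint
    fun x hx => hM.norm_le_app hx
  have hmeas : ∀ k, AEStronglyMeasurable
      (fun s => g (app M.sqrtL (K k s (app M.sqrtL (M.W s t ψ)))))
      (volume.restrict (Set.Icc 0 t)) := fun k =>
    hg.comp_aestronglyMeasurable ((hK' k).2.1 t ht ψ hψ).aestronglyMeasurable
  refine ⟨fun k => (hmeas k).mk _, fun k => (hmeas k).stronglyMeasurable_mk, ?_⟩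
  filter_upwards [ae_restrict_mem measurableSet_Icc, ae_all_iff.2 fun k => (hmeas k).ae_eq_mk]
    with r hr hae Y hY
  have hv : ∀ k, (hmeas k).mk _ r = K k r (app M.sqrtL (M.W r t ψ)) := fun k => by
    rw [← hae k]
    exact hgS _ ((hK' k).1 r hr.1 _ (hM.W_mem r t hr.1 hr.2 ψ hψ))
  simp only [hv]
  have hs := hK r hr.1 Y (app M.sqrtL (M.W r t ψ)) (app M.sqrtL (M.W r t ψ))
  have hs' : HasSum (fun k => qf Y (K k r (app M.sqrtL (M.W r t ψ)))) (M.flux t ψ r Y) :=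
    Complex.hasSum_re hs
  rw [← hs'.tsum_eq, ENNReal.ofReal_tsum_of_nonneg (fun k => qf_nonneg hY _) hs'.summable]

variable [TopologicalSpace.SeparableSpace H]

/-- Both `A r` and its argument vary with `r`, so ultraweak continuity of `A` at a fixed operator
does not suffice. The Kraus vectors turn the flux into a sum of forms of `Y r` at measurable
vectors. -/
lemma aemeasurable_flux {t : ℝ} (ht : 0 ≤ t) {ψ : H} (hψ : ψ ∈ M.D) {Y : ℝ → H →L[ℂ] H}
    (hY : ∀ r, 0 ≤ Y r) (hYm : ∀ χ, Measurable fun r => qf (Y r) χ) :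
    AEMeasurable (fun r => M.flux t ψ r (Y r)) (volume.restrict (Set.Icc 0 t)) := by
  obtain ⟨v, hv, hae⟩ := hM.exists_kraus_vectors ht hψ
  have hm : Measurable fun r => (∑' k, ENNReal.ofReal (qf (Y r) (v k r))).toReal :=
    (Measurable.tsum fun k =>
      (measurable_qf_comp hYm (hv k)).ennreal_ofReal).ennreal_toReal
  refine hm.aemeasurable.congr ?_
  filter_upwards [hae] with r hr
  rw [← hr _ (hY r), ENNReal.toReal_ofReal (M.flux_nonneg _ _ _ (hY r))]

lemma integrableOn_flux {t : ℝ} (ht : 0 ≤ t) {ψ : H} (hψ : ψ ∈ M.D) {Y : ℝ → H →L[ℂ] H}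
    (hY : ∀ r, 0 ≤ Y r) (hYm : ∀ χ, Measurable fun r => qf (Y r) χ) {c : ℝ}
    (hYc : ∀ r, ‖Y r‖ ≤ c) : IntegrableOn (fun r => M.flux t ψ r (Y r)) (Set.Icc 0 t) := by
  obtain ⟨C, hC⟩ := hM.A_bounded
  have hL2 := (hM.memLp t ht ψ hψ).integrable_norm_pow (by norm_num)
  refine (hL2.const_mul (|C| * c)).mono' (hM.aemeasurable_flux ht hψ hY hYm).aestronglyMeasurable ?_
  filter_upwards [ae_restrict_mem measurableSet_Icc] with r hr
  rw [Real.norm_of_nonneg (M.flux_nonneg _ _ _ (hY r)), flux_eq_qf]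
  refine (qf_le_norm _ _).trans ?_
  gcongr
  calc ‖M.A r (Y r)‖ ≤ C * ‖Y r‖ := hC r hr.1 _
    _ ≤ |C| * c := mul_le_mul (le_abs_self C) (hYc r) (norm_nonneg _) (abs_nonneg _)

/-- Conservation of the norm: what `W_{s,t}` loses is the flux of the identity. -/
lemma integral_flux_one {s t : ℝ} (hs : 0 ≤ s) (hst : s ≤ t) {ψ : H} (hψ : ψ ∈ M.D) :
    ∫ r in s..t, M.flux t ψ r 1 = ‖ψ‖ ^ 2 - ‖M.W s t ψ‖ ^ 2 := by
  have ht := hs.trans hst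
  have hint : IntegrableOn (fun r => M.flux t ψ r 1) (Set.Icc 0 t) :=
    hM.integrableOn_flux ht hψ (Y := fun _ => 1)
      (fun _ => (ContinuousLinearMap.nonneg_iff_isPositive _).2 ContinuousLinearMap.isPositive_one)
      (fun χ => measurable_const) (fun _ => le_rfl)
  have hderiv : ∀ r ∈ Set.Icc 0 t, HasDerivWithinAt (fun r => ‖M.W r t ψ‖ ^ 2) (M.flux t ψ r 1)
      (Set.Icc 0 t) r := by
    intro r hr
    -- The real structure serves to differentiate the squared norm: the derivative is `2 Re ⟪φ, G φ⟫
    -- = Re ⟪φ, (G* + G) φ⟫ = Φ_r(I)[φ]` at `φ = W_{r,t} ψ`.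
    let : InnerProductSpace ℝ H := InnerProductSpace.rclikeToReal ℂ H
    have h1 := (hM.W_deriv_left r t hr.1 hr.2 ψ hψ)
    have h2 : HasDerivWithinAt _ (2 * ⟪M.W r t ψ, app (M.G r) (M.W r t ψ)⟫_ℝ) _ _ :=
      HasDerivWithinAt.norm_sq (F := H) h1
    convert h2 using 1
    set φ := M.W r t ψ
    have hφ : φ ∈ M.D := hM.W_mem r t hr.1 hr.2 ψ hψ
    have h3 := hM.adjoint_add r hr.1 φ hφ φ hφ
    have hφd := (hM.G_core r hr.1).le_domain hφ
    have h4 := LinearPMap.adjoint_isFormalAdjoint (hM.G_dense r hr.1)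
      ⟨φ, hM.D_le_adjoint r hr.1 hφ⟩ ⟨φ, hφd⟩
    rw [← app_of_mem, ← app_of_mem] at h4
    simp only at h4
    have h5 : M.flux t ψ r 1 = (⟪φ, app (M.G r).adjoint φ + app (M.G r) φ⟫_ℂ).re := by
      rw [h3]; rfl
    rw [h5, inner_add_right, Complex.add_re, ← inner_conj_symm φ (app (M.G r).adjoint φ), h4,
      Complex.conj_re, ← two_mul]
    rfl
  have := intervalIntegral.integral_eq_sub_of_hasDerivAt_of_le (f := fun r => ‖M.W r t ψ‖ ^ 2)
    (f' := fun r => M.flux t ψ r 1) hst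
    (fun r hr => (hderiv r ⟨hs.trans hr.1, hr.2⟩).continuousWithinAt.mono
      (Set.Icc_subset_Icc_left hs))
    (fun r hr => (hderiv r ⟨hs.trans hr.1.le, hr.2.le⟩).hasDerivAt
      (Icc_mem_nhds (hs.trans_lt hr.1) hr.2))
    ((intervalIntegrable_iff_integrableOn_Icc_of_le hst).2
      (hint.mono_set (Set.Icc_subset_Icc_left hs)))
  rw [this, hM.W_self t ht]
  simp

end Assumptions

end Data

end

/-! ### One step of the iteration, the approximants and their least upper bound. -/

variable [CompleteSpace H]

lemma one_op_nonneg : (0 : H →L[ℂ] H) ≤ 1 :=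
  (ContinuousLinearMap.nonneg_iff_isPositive _).2 ContinuousLinearMap.isPositive_one

/-- A family of positive operators on `[s, ∞)`, bounded by `c` and weakly continuous. -/
structure RegularFamily (s c : ℝ) (Y : ℝ → H →L[ℂ] H) : Prop where
  nonneg : ∀ r, s ≤ r → 0 ≤ Y r
  bound : ∀ r, s ≤ r → ∀ χ, qf (Y r) χ ≤ c * ‖χ‖ ^ 2
  cont : ∀ χ, ContinuousOn (fun r => qf (Y r) χ) (Set.Ici s)

/-- A regular family is controlled only on `[s, ∞)`. Freezing it at `s` for earlier times gives a
family on the whole line, as the flux lemmas require. -/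
lemma RegularFamily.measurable_max {s c : ℝ} {Y : ℝ → H →L[ℂ] H} (h : RegularFamily s c Y) (χ : H) :
    Measurable fun r => qf (Y (max s r)) χ :=
  ((h.cont χ).comp_continuous (f := fun r => max s r) (by fun_prop)
    fun r => le_max_left s r).measurable

namespace Data

variable {M : Data H}

lemma qf_V (s t : ℝ) (X : H →L[ℂ] H) (ψ : H) : qf (M.V s t X) ψ = qf X (M.W s t ψ) := by
  simp only [qf, V, ContinuousLinearMap.comp_apply, ContinuousLinearMap.adjoint_inner_right]

lemma V_nonneg (s t : ℝ) {X : H →L[ℂ] H} (hX : 0 ≤ X) : 0 ≤ M.V s t X := by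
  rw [ContinuousLinearMap.nonneg_iff_isPositive] at *
  exact hX.adjoint_conj _

variable (M) in
/-- One step of the iteration: the form `V_{s,t}(X) + ∫_s^t V_{r,t} Φ_r(Y_r) dr`. -/
def step (s : ℝ) (X : H →L[ℂ] H) (Y : ℝ → H →L[ℂ] H) (t : ℝ) : H →L[ℂ] H :=
  opOfForm M.D fun ψ => ⟪ψ, M.V s t X ψ⟫_ℂ + ∫ r in s..t, M.phi r (Y r) (M.W r t ψ) (M.W r t ψ)

namespace Assumptions

variable (hM : M.Assumptions)
include hM

variable [TopologicalSpace.SeparableSpace H]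

lemma integrableOn_flux_of_regular {s t c : ℝ} (hs : 0 ≤ s) (hst : s ≤ t) {ψ : H} (hψ : ψ ∈ M.D)
    (hc : 0 ≤ c) {Y : ℝ → H →L[ℂ] H} (hY : RegularFamily s c Y) :
    IntegrableOn (fun r => M.flux t ψ r (Y r)) (Set.Icc s t) := by
  have h := hM.integrableOn_flux (hs.trans hst) hψ (Y := fun r => Y (max s r))
    (fun r => hY.nonneg _ (le_max_left _ _)) hY.measurable_max (c := c)
    (fun r => norm_le_of_qf_le (hY.nonneg _ (le_max_left _ _)) hc
      (hY.bound _ (le_max_left _ _)))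
  refine (h.mono_set (Set.Icc_subset_Icc_left hs)).congr_fun (fun r hr => ?_) measurableSet_Icc
  simp only [max_eq_right hr.1]

lemma intervalIntegrable_flux {s a b t c : ℝ} (hs : 0 ≤ s) (hsa : s ≤ a) (hab : a ≤ b)
    (hbt : b ≤ t) {ψ : H} (hψ : ψ ∈ M.D)
    (hc : 0 ≤ c) {Y : ℝ → H →L[ℂ] H} (hY : RegularFamily s c Y) :
    IntervalIntegrable (fun r => M.flux t ψ r (Y r)) volume a b := by
  rw [intervalIntegrable_iff_integrableOn_Icc_of_le hab]
  exact (hM.integrableOn_flux_of_regular hs (hsa.trans (hab.trans hbt)) hψ hc hY).mono_set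
    (Set.Icc_subset_Icc hsa hbt)

lemma regular_one (s : ℝ) : RegularFamily s 1 (fun _ => (1 : H →L[ℂ] H)) where
  nonneg := fun _ _ => one_op_nonneg
  bound := fun _ _ χ => by rw [qf_one, one_mul]
  cont := fun _ => continuousOn_const

/-- Because `Y r ≤ c I`, its flux is at most `c` times that of the identity, which integrates
exactly to the norm lost by `W_{a,t}`. This exactness keeps the constant `c` unchanged under the
iteration. -/
lemma integral_flux_le {s a t c : ℝ} (hs : 0 ≤ s) (hsa : s ≤ a) (hat : a ≤ t) {ψ : H}
    (hψ : ψ ∈ M.D) (hc : 0 ≤ c) {Y : ℝ → H →L[ℂ] H} (hY : RegularFamily s c Y) :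
    ∫ r in a..t, M.flux t ψ r (Y r) ≤ c * (‖ψ‖ ^ 2 - ‖M.W a t ψ‖ ^ 2) := by
  rw [← hM.integral_flux_one (hs.trans hsa) hat hψ, ← intervalIntegral.integral_const_mul]
  refine intervalIntegral.integral_mono_on hat
    (hM.intervalIntegrable_flux hs hsa hat le_rfl hψ hc hY)
    ((hM.intervalIntegrable_flux hs hsa hat le_rfl hψ zero_le_one (hM.regular_one s)).const_mul c)
    fun r hr => ?_
  exact M.flux_le t ψ r (hY.nonneg r (hsa.trans hr.1)) hc (hY.bound r (hsa.trans hr.1))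

lemma integral_flux_nonneg {s a t c : ℝ} (hsa : s ≤ a) (hat : a ≤ t) {ψ : H}
    {Y : ℝ → H →L[ℂ] H} (hY : RegularFamily s c Y) :
    0 ≤ ∫ r in a..t, M.flux t ψ r (Y r) :=
  intervalIntegral.integral_nonneg hat fun r hr => M.flux_nonneg t ψ r (hY.nonneg r (hsa.trans hr.1))

lemma integral_phi_eq {s t c : ℝ} (hst : s ≤ t) {ψ : H}
    {Y : ℝ → H →L[ℂ] H} (hY : RegularFamily s c Y) :
    ∫ r in s..t, M.phi r (Y r) (M.W r t ψ) (M.W r t ψ)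
      = ((∫ r in s..t, M.flux t ψ r (Y r) : ℝ) : ℂ) := by
  rw [← intervalIntegral.integral_ofReal]
  refine intervalIntegral.integral_congr fun r hr => ?_
  rw [Set.uIcc_of_le hst] at hr
  exact M.phi_eq_flux t ψ r (hY.nonneg r hr.1)

/-- The form `∫_s^t V_{r,t} Φ_r(Y_r) dr` comes from a bounded operator. -/
lemma exists_op_integral_flux {s t c : ℝ} (hs : 0 ≤ s) (hst : s ≤ t) (hc : 0 ≤ c)
    {Y : ℝ → H →L[ℂ] H} (hY : RegularFamily s c Y) :
    ∃ T : H →L[ℂ] H, ∀ ψ ∈ M.D,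
      ⟪ψ, T ψ⟫_ℂ = ∫ r in s..t, M.phi r (Y r) (M.W r t ψ) (M.W r t ψ) := by
  let u : ℝ → M.D → H := fun r x => app M.sqrtL (M.W r t x)
  have hdom : ∀ r ∈ Set.Ioc s t, ∀ x : M.D, M.W r t x ∈ M.sqrtL.domain := fun r hr x =>
    hM.W_mem_sqrt (hs.trans hr.1.le) hr.2 x.2
  have hu_add : ∀ r ∈ Set.Ioc s t, ∀ x y, u r (x + y) = u r x + u r y := fun r hr x y => by
    simp only [u, Submodule.coe_add, map_add]
    exact app_add (hdom r hr x) (hdom r hr y)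
  have hu_smul : ∀ r ∈ Set.Ioc s t, ∀ (a : ℂ) x, u r (a • x) = a • u r x := fun r hr a x => by
    simp only [u, Submodule.coe_smul, map_smul]
    exact app_smul a (hdom r hr x)
  have hu_sub : ∀ r ∈ Set.Ioc s t, ∀ x y, u r (x - y) = u r x - u r y := fun r hr x y => by
    have h1 := hu_add r hr x ((-1 : ℂ) • y)
    rw [hu_smul r hr] at h1
    simpa [sub_eq_add_neg] using h1
  let β : ℝ → M.D → M.D → ℂ := fun r x y => ⟪u r x, M.A r (Y r) (u r y)⟫_ℂ
  have hpos : ∀ r ∈ Set.Ioc s t, (M.A r (Y r)).IsPositive := fun r hr =>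
    (ContinuousLinearMap.nonneg_iff_isPositive _).1 (M.A_nonneg r (hY.nonneg r hr.1.le))
  have hdiag : ∀ r ∈ Set.Ioc s t, ∀ x, ⟪M.A r (Y r) (u r x), u r x⟫_ℂ = (M.flux t x r (Y r) : ℂ) :=
    fun r hr x => by
      rw [(hpos r hr).inner_left_eq_inner_right]
      exact M.phi_eq_flux t x r (hY.nonneg r hr.1.le)
  have hint_diag : ∀ x : M.D, Integrable (fun r => (M.flux t x r (Y r) : ℂ))
      (volume.restrict (Set.Ioc s t)) := fun x =>
    ((hM.integrableOn_flux_of_regular hs hst x.2 hc hY).mono_set Set.Ioc_subset_Icc_self).ofReal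
  -- Integrability is known on the diagonal only; polarization carries it to pairs.
  have hint : ∀ x y, Integrable (fun r => β r x y) (volume.restrict (Set.Ioc s t)) := by
    intro x y
    have h := (((((hint_diag (y + x)).sub (hint_diag (y - x))).add
      ((hint_diag (y + Complex.I • x)).const_mul Complex.I)).sub
      ((hint_diag (y - Complex.I • x)).const_mul Complex.I))).div_const 4
    refine h.congr ?_
    filter_upwards [ae_restrict_mem measurableSet_Ioc] with r hr
    have hp := inner_map_polarization (M.A r (Y r) : H →ₗ[ℂ] H) (u r y) (u r x)
    simp only [ContinuousLinearMap.coe_coe] at hp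
    rw [← hu_add r hr, ← hu_sub r hr, ← hu_smul r hr, ← hu_add r hr, ← hu_sub r hr, hdiag r hr,
      hdiag r hr, hdiag r hr, hdiag r hr, (hpos r hr).inner_left_eq_inner_right] at hp
    exact hp.symm
  let b : M.D → M.D → ℂ := fun x y => ∫ r in Set.Ioc s t, β r x y
  have hb_diag : ∀ x : M.D, b x x = ((∫ r in s..t, M.flux t x r (Y r) : ℝ) : ℂ) := fun x => by
    rw [← hM.integral_phi_eq hst hY, intervalIntegral.integral_of_le hst]
    rfl
  have hcongr : ∀ {f g : ℝ → ℂ}, (∀ r ∈ Set.Ioc s t, f r = g r) →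
      ∫ r in Set.Ioc s t, f r = ∫ r in Set.Ioc s t, g r := fun h =>
    setIntegral_congr_fun measurableSet_Ioc h
  have hadd_l : ∀ x y z, b (x + y) z = b x z + b y z := fun x y z => by
    simp only [b]
    rw [← integral_add (hint x z) (hint y z)]
    refine hcongr fun r hr => ?_
    simp only [β, hu_add r hr, inner_add_left]
  have hadd_r : ∀ x y z, b x (y + z) = b x y + b x z := fun x y z => by
    simp only [b]
    rw [← integral_add (hint x y) (hint x z)]
    refine hcongr fun r hr => ?_
    simp only [β, hu_add r hr, map_add, inner_add_right]
  have hsmul_l : ∀ (a : ℂ) x z, b (a • x) z = starRingEnd ℂ a * b x z := fun a x z => by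
    simp only [b]
    rw [← integral_const_mul]
    refine hcongr fun r hr => ?_
    simp only [β, hu_smul r hr, inner_smul_left]
  have hsmul_r : ∀ (a : ℂ) x z, b x (a • z) = a * b x z := fun a x z => by
    simp only [b]
    rw [← integral_const_mul]
    refine hcongr fun r hr => ?_
    simp only [β, hu_smul r hr, map_smul, inner_smul_right]
  have hsymm : ∀ x y, starRingEnd ℂ (b y x) = b x y := fun x y => by
    simp only [b]
    rw [← integral_conj]
    refine hcongr fun r hr => ?_
    simp only [β]
    rw [inner_conj_symm, (hpos r hr).inner_left_eq_inner_right]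
  have hle : ∀ x : M.D, (b x x).re ≤ c * ‖x‖ ^ 2 := fun x => by
    rw [hb_diag, Complex.ofReal_re]
    refine (hM.integral_flux_le hs le_rfl hst x.2 hc hY).trans ?_
    gcongr
    simp
  have hnn : ∀ x : M.D, 0 ≤ (b x x).re := fun x => by
    rw [hb_diag, Complex.ofReal_re]
    exact hM.integral_flux_nonneg le_rfl hst hY
  obtain ⟨T, hT⟩ := exists_op_of_sesq hM.dense_D b hadd_l hsmul_l hadd_r hsmul_r
    (norm_sesq_le b hadd_l hsmul_l hsymm hnn hle)
  refine ⟨T, fun ψ hψ => ?_⟩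
  rw [hT ⟨ψ, hψ⟩ ⟨ψ, hψ⟩, hb_diag, ← hM.integral_phi_eq hst hY]

section Step

variable {s c : ℝ} (hs : 0 ≤ s) (hc : 0 ≤ c) {X : H →L[ℂ] H} (hX : 0 ≤ X)
  {Y : ℝ → H →L[ℂ] H} (hY : RegularFamily s c Y)
include hs hc hX hY

lemma inner_step {t : ℝ} (hst : s ≤ t) {ψ : H} (hψ : ψ ∈ M.D) :
    ⟪ψ, M.step s X Y t ψ⟫_ℂ
      = ((qf X (M.W s t ψ) + ∫ r in s..t, M.flux t ψ r (Y r) : ℝ) : ℂ) := by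
  obtain ⟨T, hT⟩ := hM.exists_op_integral_flux hs hst hc hY
  have h : ∃ T₀ : H →L[ℂ] H, ∀ ψ ∈ M.D, ⟪ψ, T₀ ψ⟫_ℂ
      = ⟪ψ, M.V s t X ψ⟫_ℂ + ∫ r in s..t, M.phi r (Y r) (M.W r t ψ) (M.W r t ψ) :=
    ⟨M.V s t X + T, fun ψ hψ => by rw [add_apply, inner_add_right, hT ψ hψ]⟩
  unfold step
  rw [opOfForm_apply h hψ, hM.integral_phi_eq hst hY, inner_eq_qf (M.V_nonneg s t hX), qf_V]
  push_cast
  rfl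

lemma qf_step {t : ℝ} (hst : s ≤ t) {ψ : H} (hψ : ψ ∈ M.D) :
    qf (M.step s X Y t) ψ = qf X (M.W s t ψ) + ∫ r in s..t, M.flux t ψ r (Y r) := by
  rw [qf, hM.inner_step hs hc hX hY hst hψ, Complex.ofReal_re]

lemma step_nonneg {t : ℝ} (hst : s ≤ t) : 0 ≤ M.step s X Y t :=
  nonneg_of_forall_mem_dense hM.dense_D fun _ψ hψ =>
    ⟨_, add_nonneg (qf_nonneg hX _) (hM.integral_flux_nonneg le_rfl hst hY),
      hM.inner_step hs hc hX hY hst hψ⟩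

/-- On the core the two contributions are at most `c ‖Wψ‖²` and `c (‖ψ‖² - ‖Wψ‖²)`, which add up to
`c ‖ψ‖²`. -/
lemma qf_step_le (hXc : ∀ χ, qf X χ ≤ c * ‖χ‖ ^ 2) {t : ℝ} (hst : s ≤ t) (χ : H) :
    qf (M.step s X Y t) χ ≤ c * ‖χ‖ ^ 2 := by
  have hcl : IsClosed {χ : H | qf (M.step s X Y t) χ ≤ c * ‖χ‖ ^ 2} :=
    isClosed_le (continuous_qf _) (by fun_prop)
  refine hcl.closure_subset_iff.2 (fun ψ hψ => ?_) (hM.dense_D χ)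
  show qf (M.step s X Y t) ψ ≤ c * ‖ψ‖ ^ 2
  rw [hM.qf_step hs hc hX hY hst hψ]
  linarith [hXc (M.W s t ψ), hM.integral_flux_le hs le_rfl hst hψ hc hY]

lemma qf_step_split {t t' : ℝ} (hst : s ≤ t) (htt' : t ≤ t') {ψ : H} (hψ : ψ ∈ M.D) :
    qf (M.step s X Y t') ψ
      = qf (M.step s X Y t) (M.W t t' ψ) + ∫ r in t..t', M.flux t' ψ r (Y r) := by
  have hψ' := hM.W_mem t t' (hs.trans hst) htt' ψ hψ
  rw [hM.qf_step hs hc hX hY (hst.trans htt') hψ, hM.qf_step hs hc hX hY hst hψ',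
    hM.W_comp_apply hs hst htt', ← intervalIntegral.integral_add_adjacent_intervals
      (hM.intervalIntegrable_flux hs le_rfl hst htt' hψ hc hY)
      (hM.intervalIntegrable_flux hs hst htt' le_rfl hψ hc hY), ← add_assoc]
  congr 2
  refine intervalIntegral.integral_congr fun r hr => ?_
  rw [Set.uIcc_of_le hst] at hr
  simp only [flux, hM.W_comp_apply (hs.trans hr.1) hr.2 htt']

/-- By the splitting at `t`, the increment is the change of one bounded form from `ψ` to `W_{t,t'}
ψ`, plus the flux over `[t, t']`. Each is at most `2c ‖ψ‖ ‖W_{t,t'} ψ - ψ‖`, the second because the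
flux is controlled by the loss of norm. The estimate no longer involves `Λ`, so it extends from the
core to all vectors. -/
lemma abs_qf_step_sub_le (hXc : ∀ χ, qf X χ ≤ c * ‖χ‖ ^ 2) {t t' : ℝ} (hst : s ≤ t)
    (htt' : t ≤ t') (χ : H) :
    |qf (M.step s X Y t') χ - qf (M.step s X Y t) χ| ≤ 4 * c * ‖χ‖ * ‖M.W t t' χ - χ‖ := by
  have hcl : IsClosed {χ : H | |qf (M.step s X Y t') χ - qf (M.step s X Y t) χ|
      ≤ 4 * c * ‖χ‖ * ‖M.W t t' χ - χ‖} :=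
    isClosed_le ((continuous_qf _).sub (continuous_qf _)).abs (by fun_prop)
  refine hcl.closure_subset_iff.2 (fun ψ hψ => ?_) (hM.dense_D χ)
  show |qf (M.step s X Y t') ψ - qf (M.step s X Y t) ψ| ≤ 4 * c * ‖ψ‖ * ‖M.W t t' ψ - ψ‖
  have ht := hs.trans hst
  have hW := hM.norm_W_le ht htt' ψ
  have h1 := abs_qf_sub_qf_le (M.step s X Y t) (M.W t t' ψ) ψ
  have h2 : ‖M.step s X Y t‖ ≤ c := norm_le_of_qf_le (hM.step_nonneg hs hc hX hY hst) hc
    (hM.qf_step_le hs hc hX hY hXc hst)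
  have h3 := hM.integral_flux_le hs hst htt' hψ hc hY
  have h4 : 0 ≤ ∫ r in t..t', M.flux t' ψ r (Y r) := hM.integral_flux_nonneg hst htt' hY
  have h5 : ‖ψ‖ - ‖M.W t t' ψ‖ ≤ ‖M.W t t' ψ - ψ‖ := by
    rw [norm_sub_rev]; exact norm_sub_norm_le _ _
  rw [hM.qf_step_split hs hc hX hY hst htt' hψ, add_sub_right_comm]
  refine (abs_add_le _ _).trans ?_
  rw [abs_of_nonneg h4]
  have h6 : ‖M.step s X Y t‖ * (‖M.W t t' ψ‖ + ‖ψ‖) * ‖M.W t t' ψ - ψ‖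
      ≤ c * (‖ψ‖ + ‖ψ‖) * ‖M.W t t' ψ - ψ‖ := by gcongr
  have h7 : c * (‖ψ‖ ^ 2 - ‖M.W t t' ψ‖ ^ 2) ≤ c * ((‖ψ‖ + ‖ψ‖) * ‖M.W t t' ψ - ψ‖) := by
    gcongr
    calc ‖ψ‖ ^ 2 - ‖M.W t t' ψ‖ ^ 2 = (‖ψ‖ + ‖M.W t t' ψ‖) * (‖ψ‖ - ‖M.W t t' ψ‖) := by ring
      _ ≤ (‖ψ‖ + ‖ψ‖) * ‖M.W t t' ψ - ψ‖ := by
        apply mul_le_mul _ h5 (sub_nonneg.2 hW) (by positivity)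
        linarith
  linarith

end Step

lemma continuousOn_of_abs_sub_le {s C : ℝ} (hs : 0 ≤ s) {χ : H} {f : ℝ → ℝ}
    (hf : ∀ t t', s ≤ t → t ≤ t' → |f t' - f t| ≤ C * ‖M.W t t' χ - χ‖) :
    ContinuousOn f (Set.Ici s) := by
  intro t₀ ht₀
  have hs0 : s ≤ t₀ := ht₀
  -- Ordering the pair handles both one-sided limits at once, by strong continuity at the diagonal
  -- point `(t₀, t₀)`.
  have hpair : ContinuousWithinAt (fun t => M.W (min t t₀) (max t t₀) χ) (Set.Ici s) t₀ := by
    have h1 := hM.W_cont χ (min t₀ t₀, max t₀ t₀) ⟨by simpa using hs.trans hs0, by simp⟩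
    exact ContinuousWithinAt.comp (f := fun t => (min t t₀, max t t₀)) h1
      (by fun_prop) fun t ht => ⟨le_min (hs.trans ht) (hs.trans hs0), min_le_max⟩
  have hlim : Tendsto (fun t => C * ‖M.W (min t t₀) (max t t₀) χ - χ‖) (𝓝[Set.Ici s] t₀) (𝓝 0) := by
    have h2 : Tendsto _ _ _ := (hpair.sub (continuousWithinAt_const (b := χ))).norm.const_mul C
    simpa [hM.W_self t₀ (hs.trans hs0)] using h2
  refine tendsto_iff_dist_tendsto_zero.2 (squeeze_zero' (Eventually.of_forall fun t => dist_nonneg)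
    ?_ hlim)
  filter_upwards [self_mem_nhdsWithin] with t ht
  rw [Real.dist_eq]
  rcases le_total t t₀ with h | h
  · rw [min_eq_left h, max_eq_right h, abs_sub_comm]
    exact hf t t₀ ht h
  · rw [min_eq_right h, max_eq_left h]
    exact hf t₀ t hs0 h

lemma regular_step {s c : ℝ} (hs : 0 ≤ s) (hc : 0 ≤ c) {X : H →L[ℂ] H} (hX : 0 ≤ X)
    (hXc : ∀ χ, qf X χ ≤ c * ‖χ‖ ^ 2) {Y : ℝ → H →L[ℂ] H} (hY : RegularFamily s c Y) :
    RegularFamily s c (M.step s X Y) where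
  nonneg _ hr := hM.step_nonneg hs hc hX hY hr
  bound _ hr := hM.qf_step_le hs hc hX hY hXc hr
  cont χ := hM.continuousOn_of_abs_sub_le hs (C := 4 * c * ‖χ‖) (χ := χ) fun _ _ ht htt' =>
    hM.abs_qf_step_sub_le hs hc hX hY hXc ht htt' χ

lemma regular_V {s c : ℝ} (hs : 0 ≤ s) (hc : 0 ≤ c) {X : H →L[ℂ] H} (hX : 0 ≤ X)
    (hXc : ∀ χ, qf X χ ≤ c * ‖χ‖ ^ 2) : RegularFamily s c (fun t => M.V s t X) where
  nonneg r _ := M.V_nonneg s r hX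
  bound r hr χ := by
    rw [qf_V]
    refine (hXc _).trans ?_
    gcongr
    exact hM.norm_W_le hs hr χ
  cont χ := by
    simp only [qf_V]
    refine (continuous_qf X).comp_continuousOn ?_
    exact (hM.W_cont χ).comp (f := fun t => (s, t)) (by fun_prop) fun t ht => ⟨hs, ht⟩

section Iter

variable {s c : ℝ} (hs : 0 ≤ s) (hc : 0 ≤ c) {X : H →L[ℂ] H} (hX : 0 ≤ X)
  (hXc : ∀ χ, qf X χ ≤ c * ‖χ‖ ^ 2)
include hs hc hX hXc

lemma regular_iter (n : ℕ) : RegularFamily s c (fun t => M.iter n s t X) := by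
  induction n with
  | zero => exact hM.regular_V hs hc hX hXc
  | succ n ih => exact hM.regular_step hs hc hX hXc ih

lemma qf_iter_succ (n : ℕ) {t : ℝ} (hst : s ≤ t) {ψ : H} (hψ : ψ ∈ M.D) :
    qf (M.iter (n + 1) s t X) ψ
      = qf X (M.W s t ψ) + ∫ r in s..t, M.flux t ψ r (M.iter n s r X) :=
  hM.qf_step hs hc hX (hM.regular_iter hs hc hX hXc n) hst hψ

lemma iter_le_succ (n : ℕ) {t : ℝ} (hst : s ≤ t) : M.iter n s t X ≤ M.iter (n + 1) s t X := by
  have hreg := hM.regular_iter hs hc hX hXc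
  induction n generalizing t with
  | zero =>
    refine le_of_forall_mem_dense hM.dense_D ((hreg 0).nonneg t hst) ((hreg 1).nonneg t hst)
      fun ψ hψ => ?_
    rw [hM.qf_iter_succ hs hc hX hXc 0 hst hψ]
    have := hM.integral_flux_nonneg (ψ := ψ) le_rfl hst (hreg 0)
    have h0 : qf (M.iter 0 s t X) ψ = qf X (M.W s t ψ) := qf_V s t X ψ
    linarith
  | succ n ih =>
    refine le_of_forall_mem_dense hM.dense_D ((hreg (n + 1)).nonneg t hst)
      ((hreg (n + 2)).nonneg t hst) fun ψ hψ => ?_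
    rw [hM.qf_iter_succ hs hc hX hXc _ hst hψ, hM.qf_iter_succ hs hc hX hXc _ hst hψ]
    gcongr
    refine intervalIntegral.integral_mono_on hst
      (hM.intervalIntegrable_flux hs le_rfl hst le_rfl hψ hc (hreg n))
      (hM.intervalIntegrable_flux hs le_rfl hst le_rfl hψ hc (hreg (n + 1)))
      fun r hr => M.flux_mono t ψ r (ih hr.1)

lemma monotone_iter {t : ℝ} (hst : s ≤ t) : Monotone fun n => M.iter n s t X :=
  monotone_nat_of_le_succ fun n => hM.iter_le_succ hs hc hX hXc n hst

lemma iter_mono_op {X' : H →L[ℂ] H} {c' : ℝ} (hc' : 0 ≤ c') (hXX' : X ≤ X')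
    (hXc' : ∀ χ, qf X' χ ≤ c' * ‖χ‖ ^ 2) (n : ℕ) {t : ℝ} (hst : s ≤ t) :
    M.iter n s t X ≤ M.iter n s t X' := by
  have hX' := hX.trans hXX'
  have hreg := hM.regular_iter hs hc hX hXc
  have hreg' := hM.regular_iter hs hc' hX' hXc'
  induction n generalizing t with
  | zero =>
    refine le_of_qf_le ((hreg 0).nonneg t hst) ((hreg' 0).nonneg t hst) fun ψ => ?_
    have h0 : ∀ Z, qf (M.iter 0 s t Z) ψ = qf Z (M.W s t ψ) := fun Z => qf_V s t Z ψ
    rw [h0, h0]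
    exact qf_mono hXX' _
  | succ n ih =>
    refine le_of_forall_mem_dense hM.dense_D ((hreg (n + 1)).nonneg t hst)
      ((hreg' (n + 1)).nonneg t hst) fun ψ hψ => ?_
    rw [hM.qf_iter_succ hs hc hX hXc _ hst hψ, hM.qf_iter_succ hs hc' hX' hXc' _ hst hψ]
    refine add_le_add (qf_mono hXX' _) (intervalIntegral.integral_mono_on hst
      (hM.intervalIntegrable_flux hs le_rfl hst le_rfl hψ hc (hreg n))
      (hM.intervalIntegrable_flux hs le_rfl hst le_rfl hψ hc' (hreg' n))
      fun r hr => M.flux_mono t ψ r (ih hr.1))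

lemma qf_iter_self (n : ℕ) (χ : H) : qf (M.iter n s s X) χ = qf X χ := by
  cases n with
  | zero =>
    have h0 : qf (M.iter 0 s s X) χ = qf X (M.W s s χ) := qf_V s s X χ
    rw [h0, hM.W_self s hs, one_apply_eq_self]
  | succ n =>
    refine congrFun (Continuous.ext_on hM.dense_D (continuous_qf _) (continuous_qf _)
      fun ψ hψ => ?_) χ
    rw [hM.qf_iter_succ hs hc hX hXc n le_rfl hψ, intervalIntegral.integral_same, add_zero,
      hM.W_self s hs, one_apply_eq_self]

lemma isLUB_pMin {t : ℝ} (hst : s ≤ t) :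
    IsLUB (Set.range fun n => M.iter n s t X) (M.pMin s t X) := by
  have h : ∃ T, IsLUB (Set.range fun n => M.iter n s t X) T :=
    exists_isLUB_of_monotone (hM.monotone_iter hs hc hX hXc hst)
      (fun n => (hM.regular_iter hs hc hX hXc n).nonneg t hst)
      (fun n => (hM.regular_iter hs hc hX hXc n).bound t hst)
  unfold pMin
  rw [dif_pos h]
  exact h.choose_spec

end Iter

end Assumptions

end Data

/-! ### Bounded minorants of a positive form -/

/-- The Moreau regularization `inf_χ (‖u χ‖² + m ‖ψ - χ‖²)` of a positive form `‖u ·‖²` is the form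
of a bounded positive operator. -/
lemma exists_moreau {D : Submodule ℂ H} (u : D →ₗ[ℂ] H) {m : ℝ} (hm : 0 ≤ m) :
    ∃ X : H →L[ℂ] H, 0 ≤ X ∧
      ∀ ψ : H, IsGLB (Set.range fun χ : D => ‖u χ‖ ^ 2 + m * ‖ψ - χ‖ ^ 2) (qf X ψ) := by
  -- The infimum is the squared distance in `H ⊕ H` from `ι ψ = (√m ψ, 0)` to the subspace of
  -- vectors `j χ = (√m χ, u χ)`. It is thus the form of `ι* Q ι`, with `Q` the projection onto the
  -- orthogonal complement; no closability of `u` is needed.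
  let e : (H × H) ≃L[ℂ] WithLp 2 (H × H) := (WithLp.prodContinuousLinearEquiv 2 ℂ H H).symm
  let j : D →ₗ[ℂ] WithLp 2 (H × H) :=
    (e : (H × H) →ₗ[ℂ] WithLp 2 (H × H)) ∘ₗ ((Real.sqrt m : ℂ) • D.subtype).prod u
  let ι : H →L[ℂ] WithLp 2 (H × H) :=
    (e : (H × H) →L[ℂ] WithLp 2 (H × H)) ∘L
      ((Real.sqrt m : ℂ) • ContinuousLinearMap.id ℂ H).prod 0
  let K : Submodule ℂ (WithLp 2 (H × H)) := (LinearMap.range j).topologicalClosure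
  have hKc : CompleteSpace K := (Submodule.isClosed_topologicalClosure _).completeSpace_coe
  have hnorm : ∀ ψ (χ : D), ‖ι ψ - j χ‖ ^ 2 = ‖u χ‖ ^ 2 + m * ‖ψ - χ‖ ^ 2 := by
    intro ψ χ
    have h1 : ι ψ - j χ = WithLp.toLp 2 ((Real.sqrt m : ℂ) • (ψ - χ), - u χ) := by
      rw [smul_sub, ← zero_sub (u χ), ← Prod.mk_sub_mk, WithLp.toLp_sub]
      rfl
    rw [h1, WithLp.prod_norm_sq_eq_of_L2]
    change ‖(Real.sqrt m : ℂ) • (ψ - χ)‖ ^ 2 + ‖- u χ‖ ^ 2 = _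
    simp only [norm_smul, norm_neg, mul_pow, Complex.norm_real, Real.norm_eq_abs, sq_abs,
      Real.sq_sqrt hm]
    ring
  have hqf : ∀ ψ, qf (ι.adjoint ∘L Kᗮ.starProjection ∘L ι) ψ = ‖Kᗮ.starProjection (ι ψ)‖ ^ 2 := by
    intro ψ
    simp only [qf, ContinuousLinearMap.comp_apply, ContinuousLinearMap.adjoint_inner_right]
    have h1 := Submodule.inner_starProjection_left_eq_right Kᗮ (ι ψ) (Kᗮ.starProjection (ι ψ))
    rw [Submodule.starProjection_eq_self_iff.2 (Submodule.starProjection_apply_mem Kᗮ (ι ψ))] at h1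
    rw [← h1, inner_self_eq_norm_sq_to_K]
    norm_cast
  refine ⟨ι.adjoint ∘L Kᗮ.starProjection ∘L ι, ?_, fun ψ => ⟨?_, ?_⟩⟩
  · rw [ContinuousLinearMap.nonneg_iff_isPositive]
    exact (ContinuousLinearMap.IsPositive.of_isStarProjection
      isStarProjection_starProjection).adjoint_conj ι
  · rintro _ ⟨χ, rfl⟩
    simp only
    rw [hqf, ← hnorm]
    have hjK : Kᗮ.starProjection (j χ) = 0 := by
      rw [Submodule.starProjection_apply_eq_zero_iff, Submodule.orthogonal_orthogonal]
      exact Submodule.le_topologicalClosure _ ⟨χ, rfl⟩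
    have h2 : Kᗮ.starProjection (ι ψ) = Kᗮ.starProjection (ι ψ - j χ) := by
      rw [map_sub, hjK, sub_zero]
    rw [h2]
    gcongr
    exact Submodule.norm_starProjection_apply_le _ _
  · intro l hl
    rw [hqf]
    have hmem : K.starProjection (ι ψ) ∈ closure (Set.range j) :=
      K.starProjection_apply_mem (ι ψ)
    have hsum : Kᗮ.starProjection (ι ψ) = ι ψ - K.starProjection (ι ψ) := by
      rw [Submodule.starProjection_orthogonal_val]
    rw [hsum]
    have hcl : IsClosed {z : WithLp 2 (H × H) | l ≤ ‖ι ψ - z‖ ^ 2} :=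
      isClosed_le continuous_const (by fun_prop)
    refine hcl.closure_subset_iff.2 ?_ hmem
    rintro _ ⟨χ, rfl⟩
    show l ≤ ‖ι ψ - j χ‖ ^ 2
    rw [hnorm]
    exact hl ⟨χ, rfl⟩

namespace Data

variable {M : Data H}

namespace Assumptions

variable (hM : M.Assumptions)
include hM

lemma continuous_phi_one (χ : H) : Continuous fun s : ℝ => (M.phi (max 0 s) 1 χ χ).re := by
  classical
  have h1 : Summable fun n => ‖(Pi.single 0 (app M.sqrtL χ) : ℕ → H) n‖ ^ 2 :=
    summable_of_ne_finset_zero (s := {0}) fun n hn => by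
      have : n ≠ 0 := by simpa using hn
      simp [this]
  have h := hM.A_cont 1 _ _ h1 h1
  have h2 : ∀ t, ∑' n, ⟪(Pi.single 0 (app M.sqrtL χ) : ℕ → H) n,
      M.A t 1 ((Pi.single 0 (app M.sqrtL χ) : ℕ → H) n)⟫_ℂ = M.phi t 1 χ χ := fun t => by
    rw [tsum_eq_single 0 fun n hn => by simp [hn]]
    simp [phi]
  simp only [h2] at h
  exact Complex.continuous_re.comp (h.comp_continuous (f := fun s => max 0 s) (by fun_prop)
    fun s => le_max_left 0 s)

/-- On the core `Φₛ(I) ψ` is represented by the vector `(Gₛ* + Gₛ) ψ`. Expanding the form at `χ = ψ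
- η` gives a cross term of size at most `2 ‖η‖ ‖(Gₛ* + Gₛ) ψ‖`, absorbed into `m ‖η‖²` by completing
the square. The regularizations therefore converge to the form on the core at rate `1/m`. -/
lemma phi_one_sub_le {s : ℝ} (hs : 0 ≤ s) {χ ψ : H} (hχ : χ ∈ M.D) (hψ : ψ ∈ M.D) {m : ℝ}
    (hm : 0 < m) :
    (M.phi s 1 ψ ψ).re - ‖app (M.G s).adjoint ψ + app (M.G s) ψ‖ ^ 2 / m
      ≤ (M.phi s 1 χ χ).re + m * ‖ψ - χ‖ ^ 2 := by
  have hA : 0 ≤ M.A s 1 := M.A_nonneg s one_op_nonneg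
  have hpos := (ContinuousLinearMap.nonneg_iff_isPositive _).1 hA
  set η := ψ - χ with hη
  have hηD : η ∈ M.D := M.D.sub_mem hψ hχ
  have hχη : app M.sqrtL χ = app M.sqrtL ψ - app M.sqrtL η := by
    rw [← app_sub (hM.D_le hψ) (hM.D_le hηD), hη, sub_sub_cancel]
  have h1 : (M.phi s 1 χ χ).re
      = (M.phi s 1 ψ ψ).re - 2 * (M.phi s 1 η ψ).re + (M.phi s 1 η η).re := by
    have hsym : (M.phi s 1 ψ η).re = (M.phi s 1 η ψ).re := by
      simp only [phi]
      rw [← hpos.inner_left_eq_inner_right, ← inner_conj_symm, Complex.conj_re]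
    simp only [phi] at hsym ⊢
    rw [hχη]
    simp only [map_sub, inner_sub_left, inner_sub_right, Complex.sub_re]
    linarith
  have h2 : (M.phi s 1 η ψ).re ≤ ‖η‖ * ‖app (M.G s).adjoint ψ + app (M.G s) ψ‖ := by
    rw [← hM.adjoint_add s hs η hηD ψ hψ]
    exact (Complex.re_le_norm _).trans (norm_inner_le_norm _ _)
  have h3 : 0 ≤ (M.phi s 1 η η).re := qf_nonneg hA _
  set g := ‖app (M.G s).adjoint ψ + app (M.G s) ψ‖
  have h4 : 2 * (‖η‖ * g) ≤ g ^ 2 / m + m * ‖η‖ ^ 2 := by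
    have h5 : 0 ≤ (g - m * ‖η‖) ^ 2 / m := by positivity
    have h6 : (g - m * ‖η‖) ^ 2 / m = g ^ 2 / m + m * ‖η‖ ^ 2 - 2 * (‖η‖ * g) := by
      field_simp
      ring
    linarith
  linarith

/-- Bounded minorants of `Φ_s(I)` increasing to `Φ_s(I)` on the core, measurable in `s`. -/
lemma exists_minorants [TopologicalSpace.SeparableSpace H] :
    ∃ X : ℕ → ℝ → H →L[ℂ] H, (∀ m s, 0 ≤ X m s) ∧
      (∀ m s χ, qf (X m s) χ ≤ (m + 1) * ‖χ‖ ^ 2) ∧ (∀ s, Monotone fun m => X m s) ∧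
      (∀ m χ, Measurable fun s => qf (X m s) χ) ∧ (∀ m s, 0 ≤ s → X m s ∈ M.minorants s) ∧
      ∀ s, 0 ≤ s → ∀ ψ ∈ M.D,
        ⨆ m, ENNReal.ofReal (qf (X m s) ψ) = ENNReal.ofReal (M.phi s 1 ψ ψ).re := by
  have hex : ∀ (m : ℕ) (s : ℝ), ∃ X : H →L[ℂ] H, 0 ≤ X ∧
      ∀ ψ : H, IsGLB (Set.range fun χ : M.D =>
      (M.phi (max 0 s) 1 χ χ).re + ((m : ℝ) + 1) * ‖ψ - χ‖ ^ 2) (qf X ψ) := by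
    intro m s
    -- Factoring `A s I = b* b` writes `Φₛ(I)[χ]` as `‖b Λ^{1/2} χ‖²`, the shape required for the
    -- regularization. The weight `m + 1` is positive also for `m = 0`.
    obtain ⟨b, hb⟩ := CStarAlgebra.nonneg_iff_eq_star_mul_self.1
      (M.A_nonneg (max 0 s) one_op_nonneg)
    let u : M.D →ₗ[ℂ] H :=
      { toFun := fun χ => b (app M.sqrtL χ)
        map_add' := fun x y => by
          rw [Submodule.coe_add, app_add (hM.D_le x.2) (hM.D_le y.2), map_add]
        map_smul' := fun c x => by
          rw [Submodule.coe_smul, app_smul c (hM.D_le x.2), map_smul, RingHom.id_apply] }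
    obtain ⟨X, hX, hXu⟩ := exists_moreau u (m := (m : ℝ) + 1) (by positivity)
    refine ⟨X, hX, fun ψ => ?_⟩
    convert hXu ψ using 6 with χ
    simp only [phi, hb, u, LinearMap.coe_mk, AddHom.coe_mk, mul_apply_eq_comp,
      ContinuousLinearMap.star_eq_adjoint, ContinuousLinearMap.adjoint_inner_right]
    exact inner_self_eq_norm_sq (𝕜 := ℂ) _
  choose X hX hglb using hex
  have hle : ∀ m s ψ, ∀ χ ∈ M.D,
      qf (X m s) ψ ≤ (M.phi (max 0 s) 1 χ χ).re + ((m : ℝ) + 1) * ‖ψ - χ‖ ^ 2 :=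
    fun m s ψ χ hχ => (hglb m s ψ).1 ⟨⟨χ, hχ⟩, rfl⟩
  have hlow : ∀ (m : ℕ) s, 0 ≤ s → ∀ ψ ∈ M.D, (M.phi s 1 ψ ψ).re
      - ‖app (M.G s).adjoint ψ + app (M.G s) ψ‖ ^ 2 / ((m : ℝ) + 1) ≤ qf (X m s) ψ := by
    intro m s hs ψ hψ
    refine (hglb m s ψ).2 ?_
    rintro _ ⟨χ, rfl⟩
    simp only [max_eq_right hs]
    exact hM.phi_one_sub_le hs χ.2 hψ (by positivity)
  have hself : ∀ m s, 0 ≤ s → ∀ ψ ∈ M.D, qf (X m s) ψ ≤ (M.phi s 1 ψ ψ).re := by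
    intro m s hs ψ hψ
    simpa [max_eq_right hs] using hle m s ψ ψ hψ
  refine ⟨X, hX, fun m s χ => ?_, fun s m n hmn => ?_, fun m ψ => ?_, fun m s hs => ?_,
    fun s hs ψ hψ => ?_⟩
  · have h0 : app M.sqrtL 0 = 0 := by simpa using app_smul (T := M.sqrtL) 0 M.sqrtL.domain.zero_mem
    simpa [phi, h0] using hle m s χ 0 M.D.zero_mem
  · refine le_of_qf_le (hX m s) (hX n s) fun ψ => (hglb n s ψ).2 ?_
    rintro _ ⟨χ, rfl⟩
    refine (hle m s ψ χ χ.2).trans ?_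
    simp only
    gcongr
  · have : SecondCountableTopology H := UniformSpace.secondCountable_of_separable H
    -- To make the infimum countable, test vectors are taken dense in the graph of `Λ^{1/2}` over
    -- the core: the form is continuous in the graph topology, but need not be in the norm of `χ`.
    -- The countable family does not depend on `s`.
    let f : M.D → H × H := fun χ => (χ, app M.sqrtL χ)
    have : Nonempty (Set.range f) := ⟨⟨f 0, ⟨0, rfl⟩⟩⟩
    choose χ hχ using fun i => (TopologicalSpace.denseSeq (Set.range f) i).2
    refine measurable_of_Iio fun a => ?_
    have hset : (fun s => qf (X m s) ψ) ⁻¹' Set.Iio a = ⋃ i, {s : ℝ |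
        (M.phi (max 0 s) 1 (χ i) (χ i)).re + ((m : ℝ) + 1) * ‖ψ - χ i‖ ^ 2 < a} := by
      ext s
      simp only [Set.mem_preimage, Set.mem_Iio, Set.mem_iUnion, Set.mem_ofPred_eq]
      rw [isGLB_lt_iff (hglb m s ψ)]
      constructor
      · rintro ⟨_, ⟨η, rfl⟩, hη⟩
        have hopen : IsOpen {z : Set.range f | (⟪z.1.2, M.A (max 0 s) 1 z.1.2⟫_ℂ).re
            + ((m : ℝ) + 1) * ‖ψ - z.1.1‖ ^ 2 < a} :=
          isOpen_lt (by fun_prop) continuous_const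
        obtain ⟨i, hi⟩ := (TopologicalSpace.denseRange_denseSeq (Set.range f)).exists_mem_open
          hopen ⟨⟨f η, ⟨η, rfl⟩⟩, hη⟩
        refine ⟨i, ?_⟩
        simp only [Set.mem_ofPred_eq, ← hχ i] at hi
        exact hi
      · rintro ⟨i, hi⟩
        exact ⟨_, ⟨χ i, rfl⟩, hi⟩
    rw [hset]
    refine MeasurableSet.iUnion fun i => measurableSet_lt ?_ measurable_const
    exact ((hM.continuous_phi_one (χ i)).add continuous_const).measurable
  · exact ⟨hX m s, fun ψ hψ => hself m s hs ψ hψ⟩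
  · refine le_antisymm (iSup_le fun m => ENNReal.ofReal_le_ofReal (hself m s hs ψ hψ)) ?_
    have hlim : Tendsto (fun m : ℕ => ENNReal.ofReal ((M.phi s 1 ψ ψ).re
        - ‖app (M.G s).adjoint ψ + app (M.G s) ψ‖ ^ 2 / ((m : ℝ) + 1))) atTop
        (𝓝 (ENNReal.ofReal (M.phi s 1 ψ ψ).re)) := by
      refine ENNReal.tendsto_ofReal ?_
      have h1 := (tendsto_one_div_add_atTop_nhds_zero_nat (𝕜 := ℝ)).const_mul
        (‖app (M.G s).adjoint ψ + app (M.G s) ψ‖ ^ 2)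
      simpa [mul_one_div, div_eq_mul_inv] using h1.const_sub (M.phi s 1 ψ ψ).re
    refine le_of_tendsto hlim (Eventually.of_forall fun m => ?_)
    exact (ENNReal.ofReal_le_ofReal (hlow m s hs ψ hψ)).trans
      (le_iSup (fun m => ENNReal.ofReal (qf (X m s) ψ)) m)

end Assumptions

end Data

/-! ### Iterations with a time-dependent source -/

/-- A weakly measurable family of positive operators bounded by `c`. -/
structure BoundedSource (c : ℝ) (X : ℝ → H →L[ℂ] H) : Prop where
  nonneg : ∀ s, 0 ≤ X s
  bound : ∀ s χ, qf (X s) χ ≤ c * ‖χ‖ ^ 2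
  meas : ∀ χ, Measurable fun s => qf (X s) χ

/-- Tonelli's theorem on the triangle `τ ≤ s ≤ r ≤ t`. -/
lemma lintegral_triangle {F : ℝ → ℝ → ℝ≥0∞} (hF : Measurable (Function.uncurry F)) (τ t : ℝ) :
    ∫⁻ s in Set.Icc τ t, ∫⁻ r in Set.Icc s t, F s r
      = ∫⁻ r in Set.Icc τ t, ∫⁻ s in Set.Icc τ r, F s r := by
  let E : Set (ℝ × ℝ) := {p | τ ≤ p.1 ∧ p.1 ≤ p.2 ∧ p.2 ≤ t}
  have hE : MeasurableSet E := (measurableSet_le measurable_const measurable_fst).inter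
    ((measurableSet_le measurable_fst measurable_snd).inter
      (measurableSet_le measurable_snd measurable_const))
  have hm : AEMeasurable (Function.uncurry fun s r => E.indicator (Function.uncurry F) (s, r))
      ((volume : Measure ℝ).prod (volume : Measure ℝ)) := (hF.indicator hE).aemeasurable
  have hswap := lintegral_lintegral_swap hm
  have hl : ∀ s, ∫⁻ r, E.indicator (Function.uncurry F) (s, r)
      = (Set.Icc τ t).indicator (fun s => ∫⁻ r in Set.Icc s t, F s r) s := by
    intro s
    by_cases hs : s ∈ Set.Icc τ t
    · rw [Set.indicator_of_mem hs, ← lintegral_indicator measurableSet_Icc]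
      refine lintegral_congr fun r => ?_
      by_cases hr : r ∈ Set.Icc s t
      · rw [Set.indicator_of_mem hr, Set.indicator_of_mem (show (s, r) ∈ E from ⟨hs.1, hr⟩)]
        rfl
      · rw [Set.indicator_of_notMem hr, Set.indicator_of_notMem fun h : (s, r) ∈ E => hr h.2]
    · rw [Set.indicator_of_notMem hs]
      refine (lintegral_congr fun r => Set.indicator_of_notMem (fun h : (s, r) ∈ E => ?_) _).trans
        lintegral_zero
      exact hs ⟨h.1, h.2.1.trans h.2.2⟩
  have hr : ∀ r, ∫⁻ s, E.indicator (Function.uncurry F) (s, r)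
      = (Set.Icc τ t).indicator (fun r => ∫⁻ s in Set.Icc τ r, F s r) r := by
    intro r
    by_cases hr : r ∈ Set.Icc τ t
    · rw [Set.indicator_of_mem hr, ← lintegral_indicator measurableSet_Icc]
      refine lintegral_congr fun s => ?_
      by_cases hs : s ∈ Set.Icc τ r
      · rw [Set.indicator_of_mem hs,
          Set.indicator_of_mem (show (s, r) ∈ E from ⟨hs.1, hs.2, hr.2⟩)]
        rfl
      · rw [Set.indicator_of_notMem hs,
          Set.indicator_of_notMem fun h : (s, r) ∈ E => hs ⟨h.1, h.2.1⟩]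
    · rw [Set.indicator_of_notMem hr]
      refine (lintegral_congr fun s => Set.indicator_of_notMem (fun h : (s, r) ∈ E => ?_) _).trans
        lintegral_zero
      exact hr ⟨h.1.trans h.2.1, h.2.2⟩
  simp only [hl, hr] at hswap
  rwa [lintegral_indicator measurableSet_Icc, lintegral_indicator measurableSet_Icc] at hswap

lemma tsum_iSup_of_monotone {f : ℕ → ℕ → ℝ≥0∞} (hf : ∀ k, Monotone fun m => f m k) :
    ∑' k, ⨆ m, f m k = ⨆ m, ∑' k, f m k := by
  simp only [ENNReal.tsum_eq_iSup_sum]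
  rw [iSup_comm]
  exact iSup_congr fun a => ENNReal.finsetSum_iSup_of_monotone hf

namespace Data

variable (M : Data H)

/-- `P⁽ⁿ⁾_{s,r}(X_s)`, extended from `0 ≤ s ≤ r` to all `s`, `r`. -/
def clampIter (X : ℝ → H →L[ℂ] H) (n : ℕ) (s r : ℝ) : H →L[ℂ] H :=
  M.iter n (max 0 s) (max (max 0 s) r) (X (max 0 s))

variable {M}

lemma clampIter_eq (X : ℝ → H →L[ℂ] H) (n : ℕ) {s r : ℝ} (hs : 0 ≤ s) (hsr : s ≤ r) :
    M.clampIter X n s r = M.iter n s r (X s) := by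
  simp [clampIter, hs, hsr]

namespace Assumptions

variable (hM : M.Assumptions)
include hM

variable [TopologicalSpace.SeparableSpace H]

lemma ofReal_integral_flux {s t c : ℝ} (hs : 0 ≤ s) (hst : s ≤ t) {ψ : H} (hψ : ψ ∈ M.D)
    (hc : 0 ≤ c) {Y : ℝ → H →L[ℂ] H} (hY : RegularFamily s c Y) :
    ENNReal.ofReal (∫ r in s..t, M.flux t ψ r (Y r))
      = ∫⁻ r in Set.Icc s t, ENNReal.ofReal (M.flux t ψ r (Y r)) := by
  rw [intervalIntegral.integral_of_le hst, ← integral_Icc_eq_integral_Ioc]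
  refine ofReal_integral_eq_lintegral_ofReal
    (hM.integrableOn_flux_of_regular hs hst hψ hc hY) ?_
  filter_upwards [ae_restrict_mem measurableSet_Icc] with r hr
  exact M.flux_nonneg t ψ r (hY.nonneg r hr.1)

variable {c : ℝ} (hc : 0 ≤ c) {X : ℝ → H →L[ℂ] H} (hX : BoundedSource c X)
include hc hX

lemma clampIter_nonneg (n : ℕ) (s r : ℝ) : 0 ≤ M.clampIter X n s r :=
  (hM.regular_iter (le_max_left 0 s) hc (hX.nonneg _) (hX.bound _) n).nonneg _ (le_max_left _ _)

lemma qf_clampIter_le (n : ℕ) (s r : ℝ) (χ : H) : qf (M.clampIter X n s r) χ ≤ c * ‖χ‖ ^ 2 :=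
  (hM.regular_iter (le_max_left 0 s) hc (hX.nonneg _) (hX.bound _) n).bound _ (le_max_left _ _) χ

lemma continuous_qf_clampIter (n : ℕ) (s : ℝ) (χ : H) :
    Continuous fun r => qf (M.clampIter X n s r) χ :=
  ((hM.regular_iter (le_max_left 0 s) hc (hX.nonneg _) (hX.bound _) n).cont χ).comp_continuous
    (f := fun r => max (max 0 s) r) (by fun_prop) fun r => le_max_left _ r

lemma measurable_clampIter_uncurry {n : ℕ}
    (h : ∀ r χ, Measurable fun s => qf (M.clampIter X n s r) χ) (χ : H) :
    Measurable fun p : ℝ × ℝ => qf (M.clampIter X n p.1 p.2) χ :=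
  (measurable_uncurry_of_continuous_of_measurable
    (u := fun r s => qf (M.clampIter X n s r) χ)
    (fun s => hM.continuous_qf_clampIter hc hX n s χ) (fun r => h r χ)).comp measurable_swap

lemma measurable_tsum_clampIter {n : ℕ}
    (h : ∀ r χ, Measurable fun s => qf (M.clampIter X n s r) χ) {v : ℕ → ℝ → H}
    (hv : ∀ k, StronglyMeasurable (v k)) :
    Measurable (Function.uncurry fun s r =>
      ∑' k, ENNReal.ofReal (qf (M.clampIter X n s r) (v k r))) :=
  Measurable.tsum fun k => (measurable_qf_comp
    (hM.measurable_clampIter_uncurry hc hX h)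
    ((hv k).comp_measurable measurable_snd)).ennreal_ofReal

/-- The recursion is put into `[0, ∞]` with the Kraus vectors substituted. The vectors `v` depend on
neither `n`, `s` nor the source, so sums, suprema and integrals can be exchanged freely afterwards.
-/
lemma ofReal_qf_iter_succ (n : ℕ) {s t : ℝ} (hs : 0 ≤ s) (hst : s ≤ t) {ψ : H} (hψ : ψ ∈ M.D)
    {v : ℕ → ℝ → H}
    (hv : ∀ᵐ r ∂(volume.restrict (Set.Icc 0 t)), ∀ Y : H →L[ℂ] H, 0 ≤ Y →
        ENNReal.ofReal (M.flux t ψ r Y) = ∑' k, ENNReal.ofReal (qf Y (v k r))) :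
    ENNReal.ofReal (qf (M.clampIter X (n + 1) s t) ψ)
      = ENNReal.ofReal (qf (M.clampIter X 0 s t) ψ) + ∫⁻ r in Set.Icc s t,
        ∑' k, ENNReal.ofReal (qf (M.clampIter X n s r) (v k r)) := by
  have hreg := hM.regular_iter hs hc (hX.nonneg s) (hX.bound s)
  have h0 : qf (M.iter 0 s t (X s)) ψ = qf (X s) (M.W s t ψ) := qf_V s t (X s) ψ
  rw [clampIter_eq X _ hs hst, clampIter_eq X _ hs hst, h0,
    hM.qf_iter_succ hs hc (hX.nonneg s) (hX.bound s) n hst hψ,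
    ENNReal.ofReal_add (qf_nonneg (hX.nonneg s) _)
      (hM.integral_flux_nonneg le_rfl hst (hreg n)),
    hM.ofReal_integral_flux hs hst hψ hc (hreg n)]
  congr 1
  refine lintegral_congr_ae ?_
  filter_upwards [ae_restrict_of_ae_restrict_of_subset (Set.Icc_subset_Icc_left hs) hv,
    ae_restrict_mem measurableSet_Icc] with r hr hrs
  rw [clampIter_eq X n hs hrs.1]
  exact hr _ ((hreg n).nonneg r hrs.1)

/-- Induction on `n`. Measurability in `s` and continuity in `r` give joint measurability of the
previous approximant, and Tonelli gives measurability of the integral over `[s, t]` with moving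
endpoint. This works for `χ` in the core; other vectors follow by limits. -/
lemma measurable_qf_clampIter (n : ℕ) (t : ℝ) (χ : H) :
    Measurable fun s => qf (M.clampIter X n s t) χ := by
  have hmax : Measurable fun s : ℝ => max 0 s := by fun_prop
  have hzero : ∀ t χ, Measurable fun s => qf (M.clampIter X 0 s t) χ := by
    intro t χ
    have h0 : ∀ s, qf (M.clampIter X 0 s t) χ
        = qf (X (max 0 s)) (M.W (max 0 s) (max (max 0 s) t) χ) := fun s => qf_V _ _ _ _
    simp only [h0]
    refine measurable_qf_comp (fun χ => (hX.meas χ).comp hmax) ?_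
    refine Continuous.stronglyMeasurable ?_
    exact (hM.W_cont χ).comp_continuous (f := fun s => (max 0 s, max (max 0 s) t))
      (by fun_prop) fun s => ⟨le_max_left _ _, le_max_left _ _⟩
  induction n generalizing t χ with
  | zero => exact hzero t χ
  | succ n ih =>
    have hcore : ∀ ψ ∈ M.D, Measurable fun s => qf (M.clampIter X (n + 1) s t) ψ := by
      intro ψ hψ
      have hself : ∀ s, t ≤ max 0 s →
          qf (M.clampIter X (n + 1) s t) ψ = qf (M.clampIter X 0 s t) ψ := fun s hs => by
        simp only [clampIter, max_eq_left hs]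
        rw [hM.qf_iter_self (le_max_left 0 s) hc (hX.nonneg _) (hX.bound _),
          hM.qf_iter_self (le_max_left 0 s) hc (hX.nonneg _) (hX.bound _)]
      rcases lt_or_ge t 0 with ht | ht
      · have : ∀ s, qf (M.clampIter X (n + 1) s t) ψ = qf (M.clampIter X 0 s t) ψ := fun s =>
          hself s (ht.le.trans (le_max_left 0 s))
        simpa only [this] using hzero t ψ
      obtain ⟨v, hv, hae⟩ := hM.exists_kraus_vectors ht hψ
      let F : ℝ × ℝ → ℝ≥0∞ := Set.indicator {p | max 0 p.1 ≤ p.2}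
        (Function.uncurry fun s r => ∑' k, ENNReal.ofReal (qf (M.clampIter X n s r) (v k r)))
      have hF : Measurable F := (hM.measurable_tsum_clampIter hc hX ih hv).indicator
        (measurableSet_le (hmax.comp measurable_fst) measurable_snd)
      have hG : Measurable fun s => (ENNReal.ofReal (qf (M.clampIter X 0 s t) ψ)
          + ∫⁻ r in Set.Icc 0 t, F (s, r)).toReal :=
        ((hzero t ψ).ennreal_ofReal.add hF.lintegral_prod_right').ennreal_toReal
      convert hG using 2 with s
      have hFs : ∀ r, F (s, r) = (Set.Ici (max 0 s)).indicator (fun r =>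
          ∑' k, ENNReal.ofReal (qf (M.clampIter X n (max 0 s) r) (v k r))) r := by
        intro r
        have e : M.clampIter X n (max 0 s) r = M.clampIter X n s r := by simp [clampIter]
        by_cases hr : max 0 s ≤ r
        · rw [Set.indicator_of_mem (Set.mem_Ici.2 hr), e]
          exact Set.indicator_of_mem (s := {p : ℝ × ℝ | max 0 p.1 ≤ p.2}) (a := (s, r)) hr _
        · rw [Set.indicator_of_notMem (by simpa using hr)]
          exact Set.indicator_of_notMem (s := {p : ℝ × ℝ | max 0 p.1 ≤ p.2}) (a := (s, r)) hr _
      simp only [hFs]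
      rw [lintegral_indicator measurableSet_Ici, Measure.restrict_restrict measurableSet_Ici]
      have hinter : Set.Ici (max 0 s) ∩ Set.Icc 0 t = Set.Icc (max 0 s) t := by
        ext r
        simp only [Set.mem_inter_iff, Set.mem_Ici, Set.mem_Icc]
        exact ⟨fun h => ⟨h.1, h.2.2⟩, fun h => ⟨h.1, (le_max_left 0 s).trans h.1, h.2⟩⟩
      rw [hinter]
      rcases le_or_gt (max 0 s) t with hst | hst
      · have e : ∀ n, M.clampIter X n (max 0 s) t = M.clampIter X n s t := fun n => by
          simp [clampIter]
        have h1 := hM.ofReal_qf_iter_succ hc hX n (le_max_left 0 s) hst hψ hae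
        rw [e, e] at h1
        rw [← h1, ENNReal.toReal_ofReal (qf_nonneg (hM.clampIter_nonneg hc hX _ _ _) _)]
      · rw [Set.Icc_eq_empty (not_le.2 hst), Measure.restrict_empty, lintegral_zero_measure,
          add_zero, ENNReal.toReal_ofReal (qf_nonneg (hM.clampIter_nonneg hc hX _ _ _) _)]
        exact hself s hst.le
    obtain ⟨u, hu, hlim⟩ := mem_closure_iff_seq_limit.1 (hM.dense_D χ)
    refine measurable_of_tendsto_metrizable (fun j => hcore (u j) (hu j)) ?_
    exact tendsto_pi_nhds.2 fun s => ((continuous_qf _).tendsto χ).comp hlim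

end Assumptions

end Data

/-! ### Integrals of bounded forms and extension from a dense set. -/

lemma qf_parallelogram (X : H →L[ℂ] H) (a b : H) :
    qf X (a + b) + qf X (a - b) = 2 * qf X a + 2 * qf X b := by
  simp only [qf, map_add, map_sub, inner_add_left, inner_add_right, inner_sub_left,
    inner_sub_right, Complex.add_re, Complex.sub_re]
  ring

lemma measurable_lintegral_Icc {F : ℝ → ℝ → ℝ≥0∞} (hF : Measurable (Function.uncurry F)) (τ : ℝ) :
    Measurable fun r => ∫⁻ s in Set.Icc τ r, F s r := by
  have hE : MeasurableSet {p : ℝ × ℝ | τ ≤ p.1 ∧ p.1 ≤ p.2} :=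
    (measurableSet_le measurable_const measurable_fst).inter
      (measurableSet_le measurable_fst measurable_snd)
  have h := (hF.indicator hE).lintegral_prod_left' (μ := volume)
  convert h using 2 with r
  rw [← lintegral_indicator measurableSet_Icc]
  rfl

section IntegralForm

variable {μ : Measure ℝ} [IsFiniteMeasure μ] {c : ℝ} {Y : ℝ → H →L[ℂ] H}

lemma BoundedSource.integrable (hY : BoundedSource c Y) (χ : H) :
    Integrable (fun s => qf (Y s) χ) μ := by
  refine (integrable_const (c * ‖χ‖ ^ 2)).mono' (hY.meas χ).aestronglyMeasurable
    (Eventually.of_forall fun s => ?_)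
  rw [Real.norm_of_nonneg (qf_nonneg (hY.nonneg s) χ)]
  exact hY.bound s χ

lemma BoundedSource.continuous_integral (hc : 0 ≤ c) (hY : BoundedSource c Y) :
    Continuous fun χ => ∫ s, qf (Y s) χ ∂μ := by
  refine continuous_iff_continuousAt.2 fun χ => ?_
  refine continuousAt_of_dominated (bound := fun _ => c * (‖χ‖ + 1) ^ 2)
    (Eventually.of_forall fun φ => (hY.meas φ).aestronglyMeasurable) ?_ (integrable_const _)
    (Eventually.of_forall fun s => (continuous_qf (Y s)).continuousAt)
  filter_upwards [Metric.ball_mem_nhds χ one_pos] with φ hφ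
  refine Eventually.of_forall fun s => ?_
  rw [Real.norm_of_nonneg (qf_nonneg (hY.nonneg s) φ)]
  refine (hY.bound s φ).trans ?_
  gcongr
  have h1 : ‖φ - χ‖ < 1 := by simpa [dist_eq_norm] using hφ
  have h2 := norm_add_le χ (φ - χ)
  rw [add_sub_cancel] at h2
  linarith

lemma BoundedSource.integral_parallelogram (hY : BoundedSource c Y) (a b : H) :
    ∫ s, qf (Y s) (a + b) ∂μ + ∫ s, qf (Y s) (a - b) ∂μ
      = 2 * ∫ s, qf (Y s) a ∂μ + 2 * ∫ s, qf (Y s) b ∂μ := by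
  rw [← integral_add (hY.integrable _) (hY.integrable _), ← integral_const_mul,
    ← integral_const_mul, ← integral_add ((hY.integrable _).const_mul 2)
      ((hY.integrable _).const_mul 2)]
  simp only [qf_parallelogram]

/-- A representation of a bounded form as a supremum of integrals of bounded forms extends from a
dense set to the whole space. -/
lemma ofReal_qf_eq_iSup_of_dense {D : Set H} (hD : Dense D) {S : H →L[ℂ] H} (hS : 0 ≤ S)
    {c : ℕ → ℝ} (hc : ∀ m, 0 ≤ c m) {Y : ℕ → ℝ → H →L[ℂ] H} (hY : ∀ m, BoundedSource (c m) (Y m))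
    (h : ∀ ψ ∈ D, ENNReal.ofReal (qf S ψ) = ⨆ m, ∫⁻ s, ENNReal.ofReal (qf (Y m s) ψ) ∂μ) (χ : H) :
    ENNReal.ofReal (qf S χ) = ⨆ m, ∫⁻ s, ENNReal.ofReal (qf (Y m s) χ) ∂μ := by
  let f : ℕ → H → ℝ := fun m χ => ∫ s, qf (Y m s) χ ∂μ
  have hf : ∀ m χ, ∫⁻ s, ENNReal.ofReal (qf (Y m s) χ) ∂μ = ENNReal.ofReal (f m χ) := fun m χ =>
    (ofReal_integral_eq_lintegral_ofReal ((hY m).integrable χ)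
      (Eventually.of_forall fun s => qf_nonneg ((hY m).nonneg s) χ)).symm
  have hf0 : ∀ m χ, 0 ≤ f m χ := fun m χ =>
    integral_nonneg fun s => qf_nonneg ((hY m).nonneg s) χ
  simp only [hf] at h ⊢
  have hle : ∀ m χ, f m χ ≤ qf S χ := by
    intro m χ
    have hcl : IsClosed {χ : H | f m χ ≤ qf S χ} :=
      isClosed_le ((hY m).continuous_integral (hc m)) (continuous_qf S)
    refine hcl.closure_subset_iff.2 (fun ψ hψ => ?_) (hD χ)
    have h1 : ENNReal.ofReal (f m ψ) ≤ ENNReal.ofReal (qf S ψ) := by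
      rw [h ψ hψ]
      exact le_iSup (fun m => ENNReal.ofReal (f m ψ)) m
    exact (ENNReal.ofReal_le_ofReal_iff (qf_nonneg hS ψ)).1 h1
  have hnear : ∀ ψ ∈ D, ∀ δ > 0, ∃ m, qf S ψ ≤ f m ψ + δ := by
    intro ψ hψ δ hδ
    rcases le_or_gt (qf S ψ) 0 with h0 | h0
    · exact ⟨0, by linarith [hf0 0 ψ]⟩
    have h1 : ENNReal.ofReal (qf S ψ - δ) < ⨆ m, ENNReal.ofReal (f m ψ) := by
      rw [← h ψ hψ]
      exact (ENNReal.ofReal_lt_ofReal_iff h0).2 (by linarith)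
    obtain ⟨m, hm⟩ := lt_iSup_iff.1 h1
    have : qf S ψ - δ < f m ψ := lt_of_not_ge fun hge => hm.not_ge (ENNReal.ofReal_le_ofReal hge)
    exact ⟨m, by linarith⟩
  refine le_antisymm ?_ (iSup_le fun m => ENNReal.ofReal_le_ofReal (hle m χ))
  refine ENNReal.le_of_forall_pos_le_add fun ε hε _ => ?_
  have hε' : (0 : ℝ) < ε := hε
  have hcont : Continuous fun φ => 2 * qf S (χ - φ) := by
    have := continuous_qf S
    fun_prop
  have hev : {φ : H | 2 * qf S (χ - φ) < ε / 2} ∈ 𝓝 χ := by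
    refine (isOpen_lt hcont continuous_const).mem_nhds ?_
    show 2 * qf S (χ - χ) < ε / 2
    simp only [sub_self, qf, map_zero, inner_zero_right, Complex.zero_re, mul_zero]
    positivity
  obtain ⟨ψ, hψn, hψ⟩ := mem_closure_iff_nhds.1 (hD χ) _ hev
  have hψn' : 2 * qf S (χ - ψ) < ε / 2 := hψn
  obtain ⟨m, hm⟩ := hnear ψ hψ (ε / 4) (by positivity)
  -- The form `S - f m` is nonnegative and obeys the parallelogram law, so its value at `χ` is at
  -- most twice its value at `ψ` plus twice its value at `χ - ψ`. The choices of `m` and `ψ` make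
  -- each part at most `ε / 2`.
  have hp1 := qf_parallelogram S ψ (χ - ψ)
  have hp2 : f m (ψ + (χ - ψ)) + f m (ψ - (χ - ψ)) = 2 * f m ψ + 2 * f m (χ - ψ) :=
    (hY m).integral_parallelogram ψ (χ - ψ)
  rw [add_sub_cancel] at hp1 hp2
  have hkey : qf S χ ≤ f m χ + ε := by
    linarith [hle m (ψ - (χ - ψ)), hf0 m (χ - ψ)]
  calc ENNReal.ofReal (qf S χ) ≤ ENNReal.ofReal (f m χ + ε) := ENNReal.ofReal_le_ofReal hkey
    _ = ENNReal.ofReal (f m χ) + ε := by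
      rw [ENNReal.ofReal_add (hf0 m χ) hε'.le, ENNReal.ofReal_coe_nnreal]
    _ ≤ _ := by
      gcongr
      exact le_iSup (fun m => ENNReal.ofReal (f m χ)) m

end IntegralForm

/-! ### Sums of defects and their bound by the integral of `P^min Φ(I)`. -/

namespace Data

variable (M : Data H)

/-- The sum of the defects `I - P⁽ᵏ⁾_{τ,t}(I)`, `k ≤ n`. -/
def defectSum (n : ℕ) (τ t : ℝ) : H →L[ℂ] H :=
  ∑ k ∈ Finset.range (n + 1), (1 - M.iter k τ t 1)

variable {M}

namespace Assumptions

variable (hM : M.Assumptions)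
include hM

variable [TopologicalSpace.SeparableSpace H]

lemma regular_iter_one {τ : ℝ} (hτ : 0 ≤ τ) (n : ℕ) :
    RegularFamily τ 1 (fun t => M.iter n τ t 1) :=
  hM.regular_iter hτ zero_le_one one_op_nonneg (fun χ => by rw [qf_one, one_mul]) n

lemma iter_one_le {τ t : ℝ} (hτ : 0 ≤ τ) (hτt : τ ≤ t) (n : ℕ) : M.iter n τ t 1 ≤ 1 :=
  le_of_qf_le ((hM.regular_iter_one hτ n).nonneg t hτt) one_op_nonneg fun χ => by
    simpa [qf_one] using (hM.regular_iter_one hτ n).bound t hτt χ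

lemma regular_defect {τ : ℝ} (hτ : 0 ≤ τ) (k : ℕ) :
    RegularFamily τ 1 (fun t => 1 - M.iter k τ t 1) where
  nonneg _ hr := sub_nonneg.2 (hM.iter_one_le hτ hr k)
  bound r hr χ := by
    rw [qf_sub, qf_one]
    linarith [qf_nonneg ((hM.regular_iter_one hτ k).nonneg r hr) χ]
  cont χ := by
    simp only [qf_sub]
    exact continuousOn_const.sub ((hM.regular_iter_one hτ k).cont χ)

lemma regular_defectSum {τ : ℝ} (hτ : 0 ≤ τ) (n : ℕ) :
    RegularFamily τ (n + 1) (fun t => M.defectSum n τ t) where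
  nonneg r hr := Finset.sum_nonneg fun k _ => (hM.regular_defect hτ k).nonneg r hr
  bound r hr χ := by
    simp only [defectSum, qf_sum]
    refine (Finset.sum_le_card_nsmul _ _ (1 * ‖χ‖ ^ 2)
      fun k _ => (hM.regular_defect hτ k).bound r hr χ).trans (le_of_eq ?_)
    simp
  cont χ := by
    simp only [defectSum, qf_sum]
    exact continuousOn_finsetSum _ fun k _ => (hM.regular_defect hτ k).cont χ

lemma qf_defectSum_zero {τ t : ℝ} (hτ : 0 ≤ τ) (hτt : τ ≤ t) {ψ : H} (hψ : ψ ∈ M.D) :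
    qf (M.defectSum 0 τ t) ψ = ∫ r in τ..t, M.flux t ψ r 1 := by
  have h0 : qf (M.iter 0 τ t 1) ψ = qf 1 (M.W τ t ψ) := qf_V τ t 1 ψ
  rw [hM.integral_flux_one hτ hτt hψ, defectSum, Finset.sum_range_one, qf_sub, h0, qf_one, qf_one]

/-- Subtracting the iteration from `I = V(I) + ∫ V Φ(I)` cancels `V(I)` and shows that the defect of
index `k + 1` is the integrated flux of the defect of index `k`. Summing over `k` leaves the defect
of index `0` as the inhomogeneous term. -/
lemma qf_defectSum_succ (n : ℕ) {τ t : ℝ} (hτ : 0 ≤ τ) (hτt : τ ≤ t) {ψ : H} (hψ : ψ ∈ M.D) :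
    qf (M.defectSum (n + 1) τ t) ψ = qf (M.defectSum 0 τ t) ψ
      + ∫ r in τ..t, M.flux t ψ r (M.defectSum n τ r) := by
  have hint : ∀ k, IntervalIntegrable (fun r => M.flux t ψ r (1 - M.iter k τ r 1)) volume τ t :=
    fun k => hM.intervalIntegrable_flux hτ le_rfl hτt le_rfl hψ zero_le_one (hM.regular_defect hτ k)
  have hstep : ∀ k, qf (1 - M.iter (k + 1) τ t 1) ψ
      = ∫ r in τ..t, M.flux t ψ r (1 - M.iter k τ r 1) := by
    intro k
    simp only [flux_sub]
    rw [intervalIntegral.integral_sub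
      (hM.intervalIntegrable_flux hτ le_rfl hτt le_rfl hψ zero_le_one (hM.regular_one τ))
      (hM.intervalIntegrable_flux hτ le_rfl hτt le_rfl hψ zero_le_one (hM.regular_iter_one hτ k)),
      hM.integral_flux_one hτ hτt hψ, qf_sub, qf_one,
      hM.qf_iter_succ hτ zero_le_one one_op_nonneg (fun χ => by rw [qf_one, one_mul]) k hτt hψ,
      qf_one]
    ring
  simp only [defectSum, flux_sum]
  rw [intervalIntegral.integral_finsetSum fun k _ => hint k, Finset.sum_range_succ', qf_add,
    add_comm, zero_add, Finset.sum_range_one, qf_sum, Finset.sum_congr rfl fun k _ => hstep k]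

/-- The sum of the defects is the integral of `P⁽ⁿ⁾_{s,t} Φ_s(I)`, computed with bounded minorants
`X m s` increasing to `Φ_s(I)`. -/
lemma ofReal_qf_defectSum {X : ℕ → ℝ → H →L[ℂ] H}
    (hX : ∀ m : ℕ, BoundedSource ((m : ℝ) + 1) (X m)) (hXmono : ∀ s, Monotone fun m => X m s)
    (hXsup : ∀ s, 0 ≤ s → ∀ ψ ∈ M.D,
      ⨆ m, ENNReal.ofReal (qf (X m s) ψ) = ENNReal.ofReal (M.phi s 1 ψ ψ).re)
    (n : ℕ) {τ t : ℝ} (hτ : 0 ≤ τ) (hτt : τ ≤ t) (χ : H) :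
    ENNReal.ofReal (qf (M.defectSum n τ t) χ)
      = ⨆ m, ∫⁻ s in Set.Icc τ t, ENNReal.ofReal (qf (M.clampIter (X m) n s t) χ) := by
  have hc : ∀ m : ℕ, (0 : ℝ) ≤ (m : ℝ) + 1 := fun m => by positivity
  have hmeas : ∀ m n t χ, Measurable fun s => qf (M.clampIter (X m) n s t) χ := fun m n t χ =>
    hM.measurable_qf_clampIter (hc m) (hX m) n t χ
  have hmono : ∀ n s r, Monotone fun m => M.clampIter (X m) n s r := fun n s r m m' hmm' =>
    hM.iter_mono_op (le_max_left 0 s) (hc m) ((hX m).nonneg _) ((hX m).bound _) (hc m')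
      (hXmono _ hmm') ((hX m').bound _) n (le_max_left _ _)
  have hmono' : ∀ n s r χ, Monotone fun m => ENNReal.ofReal (qf (M.clampIter (X m) n s r) χ) :=
    fun n s r χ m m' hmm' => ENNReal.ofReal_le_ofReal (qf_mono (hmono n s r hmm') χ)
  -- The induction step evaluates the identity at Kraus vectors, which are not known to lie in the
  -- core. This is why the induction hypothesis must hold for every vector.
  have hext : ∀ n τ t, 0 ≤ τ → τ ≤ t →
      (∀ ψ ∈ M.D, ENNReal.ofReal (qf (M.defectSum n τ t) ψ)
        = ⨆ m, ∫⁻ s in Set.Icc τ t, ENNReal.ofReal (qf (M.clampIter (X m) n s t) ψ)) →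
      ∀ χ, ENNReal.ofReal (qf (M.defectSum n τ t) χ)
        = ⨆ m, ∫⁻ s in Set.Icc τ t, ENNReal.ofReal (qf (M.clampIter (X m) n s t) χ) := by
    intro n τ t hτ hτt h χ
    exact ofReal_qf_eq_iSup_of_dense hM.dense_D ((hM.regular_defectSum hτ n).nonneg t hτt) hc
      (Y := fun m s => M.clampIter (X m) n s t)
      (fun m => ⟨fun s => hM.clampIter_nonneg (hc m) (hX m) n s t,
        fun s => hM.qf_clampIter_le (hc m) (hX m) n s t, hmeas m n t⟩) h χ
  have hzero : ∀ τ t, 0 ≤ τ → τ ≤ t → ∀ ψ ∈ M.D, ENNReal.ofReal (qf (M.defectSum 0 τ t) ψ)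
      = ⨆ m, ∫⁻ s in Set.Icc τ t, ENNReal.ofReal (qf (M.clampIter (X m) 0 s t) ψ) := by
    intro τ t hτ hτt ψ hψ
    rw [hM.qf_defectSum_zero hτ hτt hψ,
      hM.ofReal_integral_flux hτ hτt hψ zero_le_one (hM.regular_one τ),
      ← lintegral_iSup (fun m => (hmeas m 0 t ψ).ennreal_ofReal)
        fun m m' hmm' s => hmono' 0 s t ψ hmm']
    refine setLIntegral_congr_fun measurableSet_Icc fun s hs => ?_
    have hs0 := hτ.trans hs.1
    simp only [flux]
    rw [← hXsup s hs0 _ (hM.W_mem s t hs0 hs.2 ψ hψ)]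
    refine iSup_congr fun m => ?_
    rw [clampIter_eq (X m) 0 hs0 hs.2]
    exact congrArg ENNReal.ofReal (qf_V s t (X m s) ψ).symm
  induction n generalizing τ t χ with
  | zero => exact hext 0 τ t hτ hτt (hzero τ t hτ hτt) χ
  | succ n ih =>
    refine hext (n + 1) τ t hτ hτt (fun ψ hψ => ?_) χ
    obtain ⟨v, hv, hae⟩ := hM.exists_kraus_vectors (hτ.trans hτt) hψ
    let F : ℕ → ℝ → ℝ → ℝ≥0∞ := fun m s r =>
      ∑' k, ENNReal.ofReal (qf (M.clampIter (X m) n s r) (v k r))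
    have hF : ∀ m, Measurable (Function.uncurry (F m)) := fun m =>
      hM.measurable_tsum_clampIter (hc m) (hX m) (hmeas m n) hv
    have hFmono : ∀ s r, Monotone fun m => F m s r := fun s r m m' hmm' =>
      ENNReal.tsum_le_tsum fun k => hmono' n s r (v k r) hmm'
    have hreg := hM.regular_defectSum hτ n
    -- The flux is expanded in Kraus vectors, the induction hypothesis is inserted at each of them,
    -- the supremum over `m` is moved out by monotone convergence, and Tonelli on the triangle
    -- exchanges `s` and `r`.
    have hflux : ∫⁻ r in Set.Icc τ t, ENNReal.ofReal (M.flux t ψ r (M.defectSum n τ r))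
        = ⨆ m, ∫⁻ s in Set.Icc τ t, ∫⁻ r in Set.Icc s t, F m s r := by
      have h1 : ∫⁻ r in Set.Icc τ t, ENNReal.ofReal (M.flux t ψ r (M.defectSum n τ r))
          = ∫⁻ r in Set.Icc τ t, ⨆ m, ∫⁻ s in Set.Icc τ r, F m s r := by
        refine lintegral_congr_ae ?_
        filter_upwards [ae_restrict_of_ae_restrict_of_subset (Set.Icc_subset_Icc_left hτ) hae,
          ae_restrict_mem measurableSet_Icc] with r hr hrτ
        rw [hr _ (hreg.nonneg r hrτ.1)]
        have h2 : ∀ k, ENNReal.ofReal (qf (M.defectSum n τ r) (v k r)) = ⨆ m,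
            ∫⁻ s in Set.Icc τ r, ENNReal.ofReal (qf (M.clampIter (X m) n s r) (v k r)) :=
          fun k => ih hτ hrτ.1 (v k r)
        simp only [h2]
        rw [tsum_iSup_of_monotone fun k m m' hmm' =>
          lintegral_mono fun s => hmono' n s r (v k r) hmm']
        refine iSup_congr fun m => ?_
        rw [← lintegral_tsum fun k => (hmeas m n r (v k r)).ennreal_ofReal.aemeasurable]
      rw [h1, lintegral_iSup']
      · exact iSup_congr fun m => (lintegral_triangle (hF m) τ t).symm
      · intro m
        exact (measurable_lintegral_Icc (hF m) τ).aemeasurable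
      · exact Eventually.of_forall fun r m m' hmm' => lintegral_mono fun s => hFmono s r hmm'
    rw [hM.qf_defectSum_succ n hτ hτt hψ,
      ENNReal.ofReal_add (qf_nonneg ((hM.regular_defectSum hτ 0).nonneg t hτt) ψ)
        (hM.integral_flux_nonneg le_rfl hτt hreg), hzero τ t hτ hτt ψ hψ,
      hM.ofReal_integral_flux hτ hτt hψ (by positivity) hreg, hflux,
      ENNReal.iSup_add_iSup_of_monotone
        (f := fun m => ∫⁻ s in Set.Icc τ t, ENNReal.ofReal (qf (M.clampIter (X m) 0 s t) ψ))
        (g := fun m => ∫⁻ s in Set.Icc τ t, ∫⁻ r in Set.Icc s t, F m s r)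
        (fun m m' hmm' => lintegral_mono fun s => hmono' 0 s t ψ hmm')
        (fun m m' hmm' => lintegral_mono fun s => lintegral_mono fun r => hFmono s r hmm')]
    refine iSup_congr fun m => ?_
    rw [← lintegral_add_left (hmeas m 0 t ψ).ennreal_ofReal]
    refine setLIntegral_congr_fun measurableSet_Icc fun s hs => ?_
    exact (hM.ofReal_qf_iter_succ (hc m) (hX m) n (hτ.trans hs.1) hs.2 hψ hae).symm

/-- For each regularization `X m s`, which is a minorant of `Φₛ(I)`, one has `P⁽ⁿ⁾(X m s) ≤ P^min(X
m s)`, a competitor in the supremum defining `P^min Φₛ(I)`. Only monotonicity of the lower integral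
is used, so measurability of `pMinPhi` in `s` plays no role. -/
lemma ofReal_qf_defectSum_le (n : ℕ) {τ t : ℝ} (hτ : 0 ≤ τ) (hτt : τ ≤ t) (χ : H) :
    ENNReal.ofReal (qf (M.defectSum n τ t) χ) ≤ M.intForm τ t χ := by
  obtain ⟨X, hX0, hXc, hXmono, hXm, hXmin, hXsup⟩ := hM.exists_minorants
  rw [hM.ofReal_qf_defectSum (fun m => ⟨hX0 m, hXc m, hXm m⟩) hXmono hXsup n hτ hτt]
  refine iSup_le fun m => setLIntegral_mono' measurableSet_Icc fun s hs => ?_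
  have hs0 := hτ.trans hs.1
  rw [clampIter_eq (X m) n hs0 hs.2]
  refine le_trans (ENNReal.ofReal_le_ofReal (qf_mono ?_ χ))
    (le_iSup₂ (f := fun (Z : H →L[ℂ] H) (_ : Z ∈ M.minorants s) =>
      ENNReal.ofReal (⟪χ, M.pMin s t Z χ⟫_ℂ).re) (X m s) (hXmin m s hs0))
  exact (hM.isLUB_pMin hs0 (by positivity) (hX0 m s) (hXc m s) hs.2).1 ⟨n, rfl⟩

end Assumptions

end Data

end MarkovMaster

end

/-- If the operator `∫_τ^t P^min_{s,t} Φₛ(I) ds` is densely defined, then the minimal solution of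
the Markov master equation is unital: `P^min_{τ,t}(I) = I`. -/
theorem theorem1p1 {H : Type*} [NormedAddCommGroup H] [InnerProductSpace ℂ H] [CompleteSpace H]
    [TopologicalSpace.SeparableSpace H] (M : MarkovMaster.Data H) (hM : M.Assumptions)
    (τ t : ℝ) (hτ : 0 ≤ τ) (hτt : τ ≤ t)
    (hdense : Dense (MarkovMaster.opDomain (M.intForm τ t))) :
    M.pMin τ t 1 = 1 := by
  open MarkovMaster in
  have hlub := hM.isLUB_pMin hτ zero_le_one one_op_nonneg
    (fun χ => by rw [qf_one, one_mul]) hτt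
  have hle : M.pMin τ t 1 ≤ 1 := hlub.2 (by rintro _ ⟨n, rfl⟩; exact hM.iter_one_le hτ hτt n)
  refine le_antisymm hle (sub_nonpos.1 ?_)
  have hdef : (0 : H →L[ℂ] H) ≤ 1 - M.pMin τ t 1 := sub_nonneg.2 hle
  refine le_of_forall_mem_dense hdense hdef le_rfl fun ψ hψ => ?_
  rw [qf_zero_op]
  by_contra! hpos
  have hfin : M.intForm τ t ψ ≠ ⊤ := hψ.1.ne
  -- A positive defect at `ψ` would make `n + 1` copies of it exceed the finite value of the form,
  -- while their sum is bounded by that value for every `n`.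
  obtain ⟨n, hn⟩ := exists_nat_gt ((M.intForm τ t ψ).toReal / qf (1 - M.pMin τ t 1) ψ)
  rw [div_lt_iff₀ hpos] at hn
  have h1 := (ENNReal.ofReal_le_iff_le_toReal hfin).1 (hM.ofReal_qf_defectSum_le n hτ hτt ψ)
  have h2 : ((n : ℝ) + 1) * qf (1 - M.pMin τ t 1) ψ ≤ qf (M.defectSum n τ t) ψ := by
    simp only [Data.defectSum, qf_sum]
    have := Finset.card_nsmul_le_sum (Finset.range (n + 1))
      (fun k => qf (1 - M.iter k τ t 1) ψ) (qf (1 - M.pMin τ t 1) ψ)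
      fun k _ => qf_mono (sub_le_sub_left (hlub.1 ⟨k, rfl⟩) 1) ψ
    simpa using this
  linarith
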